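/- For $\alpha\in\mathbb R$ and $\beta>-1$ let $\mathcal Y_{\alpha,\beta}$ be the class of all transcendental meromorphic functions $f$ in $\mathbb C$ such that the family of functions $f_h(z)=h^{-\alpha}f(h+h^{-\beta}z)$, $h\in\mathbb C$, $|h|\ge 1$ (with fixed determinations, say the principal ones, of the powers), is normal in $\mathbb C$, and no limit function $\lim_{n\to\infty}f_{h_n}$ with $h_n\to\infty$ is constant (the constant $\infty$ included); convergence is locally uniform in $\mathbb C$ with respect to the spherical metric. Let $f\in\mathcal Y_{\alpha,\beta}$ and let $\mathcal P$ denote the set of non-zero poles of $f$. Then each of the following two conditions is necessary and sufficient for the derivative $f'$ to belong to $\mathcal Y_{\alpha+\beta,\beta}$: (i) $\displaystyle\inf_{p\in\mathcal P}|p|^{\beta}\,\mathrm{dist}(p,\mathcal P\setminus\{p\})>0$; (ii) $\displaystyle\inf_{c\ne 0,\ f'(c)=0}|c|^{\beta}\,\mathrm{dist}(c,\mathcal P)>0$. Here $f'(c)=0$ refers to points $c$ that are not poles of $f$, and the infimum over the empty set is $+\infty$. -/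

import Mathlib

open Filter

namespace GeneralizedYosida

noncomputable section

/-- The chordal distance on the Riemann sphere `ℂ ∪ {∞}`. It induces the same uniform structure as
the spherical (geodesic) metric. -/
def chordalDist : OnePoint ℂ → OnePoint ℂ → ℝ
  | some a, some b => ‖a - b‖ / (Real.sqrt (1 + ‖a‖ ^ 2) * Real.sqrt (1 + ‖b‖ ^ 2))
  | some a, none => 1 / Real.sqrt (1 + ‖a‖ ^ 2)
  | none, some b => 1 / Real.sqrt (1 + ‖b‖ ^ 2)
  | none, none => 0

/-- Locally uniform convergence in `ℂ` (uniform convergence on compact sets) of sphere-valued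
functions, with respect to the spherical metric. -/
def TendstoSpherically (F : ℕ → ℂ → OnePoint ℂ) (g : ℂ → OnePoint ℂ) : Prop :=
  ∀ K : Set ℂ, IsCompact K → ∀ ε : ℝ, 0 < ε →
    ∀ᶠ n in atTop, ∀ z ∈ K, chordalDist (F n z) (g z) < ε

/-- A family of sphere-valued functions is normal in `ℂ` if every sequence of its members has a
subsequence that converges locally uniformly with respect to the spherical metric (the limit
`∞` being allowed). -/
def IsNormalFamily {ι : Type*} (F : ι → ℂ → OnePoint ℂ) : Prop :=
  ∀ u : ℕ → ι, ∃ φ : ℕ → ℕ, StrictMono φ ∧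
    ∃ g : ℂ → OnePoint ℂ, TendstoSpherically (fun n => F (u (φ n))) g

/-- The sphere-valued function given by a meromorphic function `f` (in normal form): it takes the
value `∞` exactly at the poles of `f`. -/
def sphereValue (f : ℂ → ℂ) (z : ℂ) : OnePoint ℂ :=
  open Classical in
  if meromorphicOrderAt f z < 0 then OnePoint.infty else (f z : OnePoint ℂ)

/-- `f` is meromorphic in `ℂ` and not a rational function. A meromorphic function is represented by
its normal form, i.e. it is analytic off its poles and carries the default value `0` at the
poles; every meromorphic function has exactly one such representative. -/
def IsTranscendentalMeromorphic (f : ℂ → ℂ) : Prop :=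
  MeromorphicNFOn f Set.univ ∧
    ¬ ∃ p q : Polynomial ℂ, q ≠ 0 ∧ ∀ z : ℂ, q.eval z ≠ 0 → f z = p.eval z / q.eval z

/-- The re-scaled function `f_h(z) = h^{-α} f(h + h^{-β} z)`, with principal powers. -/
def rescale (α β : ℝ) (f : ℂ → ℂ) (h : ℂ) : ℂ → ℂ :=
  fun z => h ^ (-(α : ℂ)) * f (h + h ^ (-(β : ℂ)) * z)

/-- `g` is a limit function `lim f_{h_n}` for some sequence `h_n → ∞`. -/
def IsLimitFunction (α β : ℝ) (f : ℂ → ℂ) (g : ℂ → OnePoint ℂ) : Prop :=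
  ∃ h : ℕ → ℂ, Tendsto (fun n => ‖h n‖) atTop atTop ∧
    TendstoSpherically (fun n => sphereValue (rescale α β f (h n))) g

/-- The class `Y_{α,β}` of generalised Yosida functions (for `β > -1`). -/
structure IsYosida (α β : ℝ) (f : ℂ → ℂ) : Prop where
  transcendental : IsTranscendentalMeromorphic f
  normal : IsNormalFamily fun h : {h : ℂ // 1 ≤ ‖h‖} => sphereValue (rescale α β f h)
  nonconstant : ∀ g : ℂ → OnePoint ℂ, IsLimitFunction α β f g → ¬ ∃ w, ∀ z, g z = w

/-- The set of non-zero poles of `f`. -/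
def poles (f : ℂ → ℂ) : Set ℂ := {p | p ≠ 0 ∧ meromorphicOrderAt f p < 0}

/-- The set of non-zero critical points of `f`, i.e. the non-zero zeros of `f'`; a pole of `f` is a
pole of `f'`, hence not a critical point, also if it is multiple. -/
def criticalPoints (f : ℂ → ℂ) : Set ℂ := {c | c ≠ 0 ∧ ¬ meromorphicOrderAt f c < 0 ∧ deriv f c = 0}

end

end GeneralizedYosida

namespace GeneralizedYosida

open Topology Metric Set

/-! Write `F n` for the rescalings of `f` at points `h n → ∞`, `g` for a spherical limit of them,
and `K n = 1 / F n`. The chain rule makes `(F n)'` the rescaling of `f'` with exponent `α + β`. In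
the local coordinate at `h n`, conditions (i) and (ii) say that poles of `F n` cannot merge with
each other, respectively with critical points. So everything is decided near a point `z₀` with `g z₀
= ∞`. As `g` is not constant, `K n` converges there to a holomorphic `k ≢ 0` with `k z₀ = 0`
(`ZeroLimit`).

If `f'` is in its class, a pole merging with a critical point would give a limit of the rescaled
derivatives both values `0` and `∞` at one point; this gives (ii).

Conditions (i) and (ii) are equivalent because `(z - z₀) k' / k` tends to the multiplicity of the
zero of `k`, which is not `0`. If `K n` has a single zero `p n` near `z₀`, then `(z - p n) (K n)' /
K n` extends holomorphically and, by the maximum principle, converges across `z₀`, so it cannot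
vanish at critical points tending to `z₀`. If `K n` has no critical points besides its zeros, the
reciprocal expression is holomorphic instead, and a second zero `q n → z₀` would make it vanish
(`ZeroLimit.eq_zero_of_deriv_eq_zero`, `ZeroLimit.eq_of_zeros`).

Under (ii), `1 / (F n)' = -(K n)² / (K n)'` is holomorphic near `z₀` and converges across it by the
same principle. Where `g` is finite, Weierstrass' theorem applies, so the derivatives form a normal
family. If the derivatives had a constant limit, `g` would be affine and not constant; moving the
base points far out in the local coordinate would then produce the constant limit `∞` for `f`
itself, which is excluded (`IsYosida.not_affine_limit`). -/

/-! ### The chordal metric and the inversion -/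

/-- The inversion `w ↦ 1 / w` of the Riemann sphere. -/
noncomputable def sphereInv : OnePoint ℂ → OnePoint ℂ
  | some a => if a = 0 then OnePoint.infty else ((a⁻¹ : ℂ) : OnePoint ℂ)
  | none => ((0 : ℂ) : OnePoint ℂ)

lemma sphereInv_infty : sphereInv OnePoint.infty = ((0 : ℂ) : OnePoint ℂ) := rfl

lemma sphereInv_zero : sphereInv ((0 : ℂ) : OnePoint ℂ) = OnePoint.infty := by
  change (if (0 : ℂ) = 0 then _ else _) = _
  simp

lemma sphereInv_coe {a : ℂ} (ha : a ≠ 0) :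
    sphereInv (a : OnePoint ℂ) = ((a⁻¹ : ℂ) : OnePoint ℂ) := by
  change (if a = 0 then _ else _) = _
  simp [ha]

lemma sphereInv_sphereInv (x : OnePoint ℂ) : sphereInv (sphereInv x) = x := by
  induction x using OnePoint.rec with
  | infty => rw [sphereInv_infty, sphereInv_zero]
  | coe a =>
    by_cases ha : a = 0
    · rw [ha, sphereInv_zero, sphereInv_infty]
    · rw [sphereInv_coe ha, sphereInv_coe (inv_ne_zero ha), inv_inv]

lemma chordalDist_coe_coe (a b : ℂ) : chordalDist (a : OnePoint ℂ) (b : OnePoint ℂ) =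
    ‖a - b‖ / (Real.sqrt (1 + ‖a‖ ^ 2) * Real.sqrt (1 + ‖b‖ ^ 2)) := rfl

lemma chordalDist_coe_infty (a : ℂ) : chordalDist (a : OnePoint ℂ) OnePoint.infty =
    1 / Real.sqrt (1 + ‖a‖ ^ 2) := rfl

lemma chordalDist_infty_coe (a : ℂ) : chordalDist OnePoint.infty (a : OnePoint ℂ) =
    1 / Real.sqrt (1 + ‖a‖ ^ 2) := rfl

lemma chordalDist_infty_infty : chordalDist OnePoint.infty OnePoint.infty = 0 := rfl

/-- Stereographic embedding of the Riemann sphere onto a round sphere of diameter one. -/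
noncomputable def stereo : OnePoint ℂ → WithLp 2 (ℂ × ℝ)
  | some a => WithLp.toLp 2 (((1 + ‖a‖ ^ 2)⁻¹ : ℝ) • a, ‖a‖ ^ 2 * (1 + ‖a‖ ^ 2)⁻¹)
  | none => WithLp.toLp 2 (0, 1)

/-- Pulling back a genuine metric gives symmetry and the triangle inequality at once, and lets the
general theory of uniform convergence in metric spaces be used for sphere-valued maps. -/
lemma dist_stereo (x y : OnePoint ℂ) : dist (stereo x) (stereo y) = chordalDist x y := by
  have key : ∀ a b : ℂ, dist (stereo a) (stereo b) = chordalDist a b := by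
    intro a b
    rw [chordalDist_coe_coe, WithLp.prod_dist_eq_of_L2]
    change Real.sqrt (dist (((1 + ‖a‖ ^ 2)⁻¹ : ℝ) • a) (((1 + ‖b‖ ^ 2)⁻¹ : ℝ) • b) ^ 2 +
      dist (‖a‖ ^ 2 * (1 + ‖a‖ ^ 2)⁻¹) (‖b‖ ^ 2 * (1 + ‖b‖ ^ 2)⁻¹) ^ 2) = _
    rw [← Real.sqrt_mul (by positivity), ← Real.sqrt_sq (norm_nonneg (a - b)),
      ← Real.sqrt_div (by positivity), Real.dist_eq, sq_abs, dist_eq_norm]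
    congr 1
    have ha : ‖a‖ ^ 2 = a.re ^ 2 + a.im ^ 2 := by rw [Complex.sq_norm, Complex.normSq_apply]; ring
    have hb : ‖b‖ ^ 2 = b.re ^ 2 + b.im ^ 2 := by rw [Complex.sq_norm, Complex.normSq_apply]; ring
    rw [Complex.sq_norm (_ - _), Complex.sq_norm (a - b), Complex.normSq_apply,
      Complex.normSq_apply, ha, hb]
    simp only [Complex.sub_re, Complex.sub_im, Complex.real_smul, Complex.re_ofReal_mul,
      Complex.im_ofReal_mul]
    have h1 : 1 + (a.re ^ 2 + a.im ^ 2) ≠ 0 := by positivity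
    have h2 : 1 + (b.re ^ 2 + b.im ^ 2) ≠ 0 := by positivity
    field_simp
    ring
  have key2 : ∀ a : ℂ, dist (stereo a) (stereo OnePoint.infty) = chordalDist a OnePoint.infty := by
    intro a
    rw [chordalDist_coe_infty, WithLp.prod_dist_eq_of_L2]
    change Real.sqrt (dist (((1 + ‖a‖ ^ 2)⁻¹ : ℝ) • a) 0 ^ 2 +
      dist (‖a‖ ^ 2 * (1 + ‖a‖ ^ 2)⁻¹) 1 ^ 2) = _
    rw [one_div, ← Real.sqrt_inv, Real.dist_eq, sq_abs, dist_zero_right, norm_smul, mul_pow]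
    congr 1
    rw [norm_inv, Real.norm_of_nonneg (by positivity : (0 : ℝ) ≤ 1 + ‖a‖ ^ 2)]
    have h1 : 1 + ‖a‖ ^ 2 ≠ 0 := by positivity
    field_simp
    ring
  induction x using OnePoint.rec with
  | infty =>
    induction y using OnePoint.rec with
    | infty => rw [dist_self, chordalDist_infty_infty]
    | coe b => rw [dist_comm, key2, chordalDist_coe_infty, chordalDist_infty_coe]
  | coe a =>
    induction y using OnePoint.rec with
    | infty => exact key2 a
    | coe b => exact key a b

lemma chordalDist_comm (x y : OnePoint ℂ) : chordalDist x y = chordalDist y x := by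
  rw [← dist_stereo, ← dist_stereo, dist_comm]

lemma chordalDist_self (x : OnePoint ℂ) : chordalDist x x = 0 := by
  rw [← dist_stereo, dist_self]

lemma chordalDist_triangle (x y z : OnePoint ℂ) :
    chordalDist x z ≤ chordalDist x y + chordalDist y z := by
  simp only [← dist_stereo]; exact dist_triangle _ _ _

lemma eq_of_chordalDist_eq_zero {x y : OnePoint ℂ} (h : chordalDist x y = 0) : x = y := by
  induction x using OnePoint.rec with
  | infty =>
    induction y using OnePoint.rec with
    | infty => rfl
    | coe b =>
      rw [chordalDist_infty_coe] at h
      have : 0 < 1 / Real.sqrt (1 + ‖b‖ ^ 2) := by positivity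
      exact absurd h this.ne'
  | coe a =>
    induction y using OnePoint.rec with
    | infty =>
      rw [chordalDist_coe_infty] at h
      have : 0 < 1 / Real.sqrt (1 + ‖a‖ ^ 2) := by positivity
      exact absurd h this.ne'
    | coe b =>
      rw [chordalDist_coe_coe, div_eq_zero_iff] at h
      rcases h with h | h
      · rw [sub_eq_zero.mp (norm_eq_zero.mp h)]
      · have : 0 < Real.sqrt (1 + ‖a‖ ^ 2) * Real.sqrt (1 + ‖b‖ ^ 2) := by positivity
        exact absurd h this.ne'

lemma stereo_injective : Function.Injective stereo := fun x y h =>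
  eq_of_chordalDist_eq_zero (by rw [← dist_stereo, h, dist_self])

lemma chordalDist_coe_le (a b : ℂ) : chordalDist (a : OnePoint ℂ) (b : OnePoint ℂ) ≤ ‖a - b‖ := by
  rw [chordalDist_coe_coe]
  refine div_le_self (norm_nonneg _) ?_
  have h1 : 1 ≤ Real.sqrt (1 + ‖a‖ ^ 2) := Real.one_le_sqrt.mpr (by nlinarith [sq_nonneg ‖a‖])
  have h2 : 1 ≤ Real.sqrt (1 + ‖b‖ ^ 2) := Real.one_le_sqrt.mpr (by nlinarith [sq_nonneg ‖b‖])
  nlinarith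

lemma sqrt_one_add_norm_inv_sq {a : ℂ} (ha : a ≠ 0) :
    Real.sqrt (1 + ‖a⁻¹‖ ^ 2) = Real.sqrt (1 + ‖a‖ ^ 2) / ‖a‖ := by
  have h : 0 < ‖a‖ := norm_pos_iff.mpr ha
  rw [← Real.sqrt_sq h.le, ← Real.sqrt_div (by positivity), Real.sqrt_sq h.le, norm_inv]
  congr 1
  field_simp
  ring

/-- Inversion is a rotation of the sphere. Hence poles can be treated as zeros of the reciprocals at
no cost. -/
lemma chordalDist_sphereInv (x y : OnePoint ℂ) :
    chordalDist (sphereInv x) (sphereInv y) = chordalDist x y := by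
  have key : ∀ a : ℂ, chordalDist (sphereInv a) (sphereInv OnePoint.infty) =
      chordalDist a OnePoint.infty := by
    intro a
    rw [sphereInv_infty]
    by_cases ha : a = 0
    · rw [ha, sphereInv_zero, chordalDist_comm]
    · have h : 0 < ‖a‖ := norm_pos_iff.mpr ha
      rw [sphereInv_coe ha, chordalDist_coe_coe, chordalDist_coe_infty,
        sqrt_one_add_norm_inv_sq ha, sub_zero, norm_inv]
      simp
      field_simp
  induction x using OnePoint.rec with
  | infty =>
    induction y using OnePoint.rec with
    | infty => rw [chordalDist_self, chordalDist_self]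
    | coe b => rw [chordalDist_comm, key, chordalDist_comm]
  | coe a =>
    induction y using OnePoint.rec with
    | infty => exact key a
    | coe b =>
      by_cases ha : a = 0
      · rw [ha, sphereInv_zero]
        by_cases hb : b = 0
        · rw [hb, sphereInv_zero, chordalDist_self, chordalDist_self]
        · have h := key b⁻¹
          rw [sphereInv_coe (inv_ne_zero hb), inv_inv, sphereInv_infty] at h
          rw [sphereInv_coe hb, chordalDist_comm, ← h, chordalDist_comm]
      · by_cases hb : b = 0
        · have h := key (a⁻¹)
          rw [sphereInv_coe (inv_ne_zero ha), inv_inv, sphereInv_infty] at h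
          rw [hb, sphereInv_zero, sphereInv_coe ha, h]
        · have h1 : 0 < ‖a‖ := norm_pos_iff.mpr ha
          have h2 : 0 < ‖b‖ := norm_pos_iff.mpr hb
          rw [sphereInv_coe ha, sphereInv_coe hb, chordalDist_coe_coe, chordalDist_coe_coe,
            sqrt_one_add_norm_inv_sq ha, sqrt_one_add_norm_inv_sq hb]
          have h3 : ‖a⁻¹ - b⁻¹‖ = ‖a - b‖ / (‖a‖ * ‖b‖) := by
            rw [inv_sub_inv ha hb, norm_div, norm_mul, norm_sub_rev]
          rw [h3]
          field_simp

/-- Near a finite value, spherical proximity gives Euclidean proximity. -/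
lemma exists_coe_of_chordalDist_lt (M : ℝ) {ε : ℝ} (hε : 0 < ε) :
    ∃ η > 0, ∀ (x : OnePoint ℂ) (b : ℂ), ‖b‖ ≤ M → chordalDist x b < η →
      ∃ a : ℂ, x = a ∧ ‖a - b‖ < ε := by
  wlog hM : 0 ≤ M generalizing M
  · obtain ⟨η, hη, h⟩ := this 0 le_rfl
    exact ⟨η, hη, fun x b hb => h x b (by linarith [norm_nonneg b])⟩
  have hS : 0 < 1 + M := by linarith
  have key : ∀ c : ℂ, Real.sqrt (1 + ‖c‖ ^ 2) ≤ 1 + ‖c‖ := by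
    intro c
    rw [Real.sqrt_le_left (by positivity)]
    nlinarith [norm_nonneg c]
  -- The first bound excludes `∞` and forces `‖a - b‖ < 1 + M`. The denominators in the chordal
  -- distance are then bounded, and the second bound gives `‖a - b‖ < ε / 2`.
  refine ⟨min (1 / (2 * (1 + M))) (ε / (4 * (1 + M) ^ 2)), by positivity, ?_⟩
  intro x b hb hx
  have hx1 := hx.trans_le (min_le_left _ _)
  have hx2 := hx.trans_le (min_le_right _ _)
  have hsb : Real.sqrt (1 + ‖b‖ ^ 2) ≤ 1 + M := (key b).trans (by linarith)
  induction x using OnePoint.rec with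
  | infty =>
    exfalso
    rw [chordalDist_infty_coe, one_div_lt_one_div (by positivity) (by positivity)] at hx1
    linarith
  | coe a =>
    refine ⟨a, rfl, ?_⟩
    have ht : ‖a‖ ≤ ‖a - b‖ + M := by
      have := norm_add_le (a - b) b
      rw [sub_add_cancel] at this
      linarith
    have hprod : Real.sqrt (1 + ‖a‖ ^ 2) * Real.sqrt (1 + ‖b‖ ^ 2) ≤
        (1 + M + ‖a - b‖) * (1 + M) := by
      have := key a
      gcongr
      linarith
    rw [chordalDist_coe_coe, div_lt_iff₀ (by positivity)] at hx1 hx2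
    have e1 : ‖a - b‖ < 1 / (2 * (1 + M)) * ((1 + M + ‖a - b‖) * (1 + M)) :=
      hx1.trans_le (by gcongr)
    have e2 : ‖a - b‖ < ε / (4 * (1 + M) ^ 2) * ((1 + M + ‖a - b‖) * (1 + M)) :=
      hx2.trans_le (by gcongr)
    have e3 : ‖a - b‖ < 1 + M := by
      have : 1 / (2 * (1 + M)) * ((1 + M + ‖a - b‖) * (1 + M)) = (1 + M + ‖a - b‖) / 2 := by
        field_simp
      linarith
    have e4 : ε / (4 * (1 + M) ^ 2) * ((1 + M + ‖a - b‖) * (1 + M)) <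
        ε / (4 * (1 + M) ^ 2) * ((1 + M + (1 + M)) * (1 + M)) := by gcongr
    have e5 : ε / (4 * (1 + M) ^ 2) * ((1 + M + (1 + M)) * (1 + M)) = ε / 2 := by
      field_simp
      ring
    linarith

/-! ### Spherical convergence -/

lemma tendstoSpherically_iff {F : ℕ → ℂ → OnePoint ℂ} {g : ℂ → OnePoint ℂ} :
    TendstoSpherically F g ↔
      TendstoLocallyUniformly (fun n z => stereo (F n z)) (fun z => stereo (g z)) atTop := by
  rw [tendstoLocallyUniformly_iff_forall_isCompact]
  simp only [Metric.tendstoUniformlyOn_iff, dist_comm (stereo (g _)), dist_stereo]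
  rfl

lemma TendstoSpherically.tendsto_at {F : ℕ → ℂ → OnePoint ℂ} {g : ℂ → OnePoint ℂ}
    (h : TendstoSpherically F g) (z : ℂ) :
    Tendsto (fun n => stereo (F n z)) atTop (𝓝 (stereo (g z))) :=
  (tendstoLocallyUniformlyOn_univ.mpr (tendstoSpherically_iff.mp h)).tendsto_at (mem_univ z)

lemma TendstoSpherically.comp_tendsto {F : ℕ → ℂ → OnePoint ℂ} {g : ℂ → OnePoint ℂ}
    (h : TendstoSpherically F g) {φ : ℕ → ℕ} (hφ : Tendsto φ atTop atTop) :
    TendstoSpherically (fun n => F (φ n)) g :=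
  fun K hK ε hε => hφ.eventually (h K hK ε hε)

lemma TendstoSpherically.sphereInv {F : ℕ → ℂ → OnePoint ℂ} {g : ℂ → OnePoint ℂ}
    (h : TendstoSpherically F g) :
    TendstoSpherically (fun n z => sphereInv (F n z)) (fun z => sphereInv (g z)) := by
  intro K hK ε hε
  simpa only [chordalDist_sphereInv] using h K hK ε hε

/-- Local spherical limits glue to a global one. -/
lemma exists_tendstoSpherically_of_local {F : ℕ → ℂ → OnePoint ℂ}
    (h : ∀ z₀ : ℂ, ∃ r > 0, ∃ G : ℂ → OnePoint ℂ, ∀ ε > 0, ∀ᶠ n in atTop, ∀ z ∈ ball z₀ r,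
      chordalDist (F n z) (G z) < ε) :
    ∃ g, TendstoSpherically F g := by
  choose r hr G hG using h
  have hpt : ∀ z₀, ∀ z ∈ ball z₀ (r z₀),
      Tendsto (fun n => stereo (F n z)) atTop (𝓝 (stereo (G z₀ z))) := by
    intro z₀ z hz
    rw [Metric.tendsto_nhds]
    intro ε hε
    filter_upwards [hG z₀ ε hε] with n hn
    rw [dist_stereo]
    exact hn z hz
  -- Each point uses its own local limit; these agree on overlaps, pointwise limits being unique.
  refine ⟨fun z => G z z, ?_⟩
  rw [tendstoSpherically_iff, Metric.tendstoLocallyUniformly_iff]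
  intro ε hε z₀
  refine ⟨ball z₀ (r z₀), ball_mem_nhds _ (hr z₀), ?_⟩
  filter_upwards [hG z₀ ε hε] with n hn z hz
  have : G z z = G z₀ z := stereo_injective
    (tendsto_nhds_unique (hpt z z (mem_ball_self (hr z))) (hpt z₀ z hz))
  rw [this, dist_comm, dist_stereo]
  exact hn z hz

/-! ### Meromorphic functions in normal form as maps into the sphere -/

/-- Meromorphic functions in the plane, in normal form, that do not vanish identically. -/
structure NontrivialMeromorphic (F : ℂ → ℂ) : Prop where
  nf : MeromorphicNFOn F univ
  order_ne_top : ∀ z, meromorphicOrderAt F z ≠ ⊤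

lemma analyticAt_of_not_pole {F : ℂ → ℂ} {z : ℂ} (hF : MeromorphicNFAt F z)
    (hz : ¬ meromorphicOrderAt F z < 0) : AnalyticAt ℂ F z :=
  hF.meromorphicOrderAt_nonneg_iff_analyticAt.mp (not_lt.mp hz)

lemma not_pole_of_analyticAt {F : ℂ → ℂ} {z : ℂ} (hF : AnalyticAt ℂ F z) :
    ¬ meromorphicOrderAt F z < 0 := not_lt.mpr hF.meromorphicOrderAt_nonneg

lemma eq_zero_of_pole {F : ℂ → ℂ} {z : ℂ} (hF : MeromorphicNFAt F z)
    (hz : meromorphicOrderAt F z < 0) : F z = 0 := by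
  by_contra h
  rw [hF.meromorphicOrderAt_eq_zero_iff.mpr h] at hz
  exact lt_irrefl _ hz

lemma sphereValue_of_pole {F : ℂ → ℂ} {z : ℂ} (hz : meromorphicOrderAt F z < 0) :
    sphereValue F z = OnePoint.infty := if_pos hz

lemma sphereValue_of_not_pole {F : ℂ → ℂ} {z : ℂ} (hz : ¬ meromorphicOrderAt F z < 0) :
    sphereValue F z = (F z : OnePoint ℂ) := if_neg hz

lemma sphereValue_eq_infty_iff {F : ℂ → ℂ} {z : ℂ} :
    sphereValue F z = OnePoint.infty ↔ meromorphicOrderAt F z < 0 := by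
  constructor
  · intro h
    by_contra hz
    rw [sphereValue_of_not_pole hz] at h
    exact OnePoint.coe_ne_infty _ h
  · exact sphereValue_of_pole

lemma inv_pole_iff {F : ℂ → ℂ} {z : ℂ} :
    meromorphicOrderAt F⁻¹ z < 0 ↔ 0 < meromorphicOrderAt F z ∧ meromorphicOrderAt F z ≠ ⊤ := by
  rw [meromorphicOrderAt_inv]
  cases h : meromorphicOrderAt F z with
  | top => simp
  | coe n =>
    rw [← WithTop.LinearOrderedAddCommGroup.coe_neg]
    norm_cast
    simp

namespace NontrivialMeromorphic

variable {F : ℂ → ℂ} {z : ℂ}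

lemma inv (hF : NontrivialMeromorphic F) : NontrivialMeromorphic F⁻¹ where
  nf := meromorphicNFOn_inv.mpr hF.nf
  order_ne_top z := by
    rw [meromorphicOrderAt_inv]
    lift meromorphicOrderAt F z to ℤ using hF.order_ne_top z with n
    rw [← WithTop.LinearOrderedAddCommGroup.coe_neg]
    exact WithTop.coe_ne_top

lemma nfAt (hF : NontrivialMeromorphic F) (z : ℂ) : MeromorphicNFAt F z := hF.nf (mem_univ z)

lemma pole_inv_iff (hF : NontrivialMeromorphic F) :
    meromorphicOrderAt F⁻¹ z < 0 ↔ ¬ meromorphicOrderAt F z < 0 ∧ F z = 0 := by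
  rw [inv_pole_iff]
  have h0 := (hF.nfAt z).meromorphicOrderAt_eq_zero_iff
  constructor
  · rintro ⟨h1, -⟩
    refine ⟨not_lt.mpr h1.le, ?_⟩
    by_contra h
    exact h1.ne' (h0.mpr h)
  · rintro ⟨h1, h2⟩
    refine ⟨lt_of_le_of_ne (not_lt.mp h1) fun h => ?_, hF.order_ne_top z⟩
    exact h0.mp h.symm h2

/-- The default value `0` at a pole of `F` is exactly the value of the reciprocal there, so the
pointwise inverse `F⁻¹` is already in normal form. -/
lemma sphereValue_inv (hF : NontrivialMeromorphic F) (z : ℂ) :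
    sphereValue F⁻¹ z = sphereInv (sphereValue F z) := by
  by_cases hz : meromorphicOrderAt F z < 0
  · have h1 : ¬ meromorphicOrderAt F⁻¹ z < 0 := fun h => (hF.pole_inv_iff.mp h).1 hz
    rw [sphereValue_of_pole hz, sphereValue_of_not_pole h1, sphereInv_infty, Pi.inv_apply,
      eq_zero_of_pole (hF.nfAt z) hz, inv_zero]
  · rw [sphereValue_of_not_pole hz]
    by_cases h0 : F z = 0
    · rw [sphereValue_of_pole (hF.pole_inv_iff.mpr ⟨hz, h0⟩), h0, sphereInv_zero]
    · rw [sphereValue_of_not_pole fun h => h0 (hF.pole_inv_iff.mp h).2, sphereInv_coe h0,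
        Pi.inv_apply]

lemma analyticAt_inv_of_pole (hF : NontrivialMeromorphic F) (hz : meromorphicOrderAt F z < 0) :
    AnalyticAt ℂ F⁻¹ z :=
  analyticAt_of_not_pole (hF.inv.nfAt z) fun h => (hF.pole_inv_iff.mp h).1 hz

lemma eventually_not_pole_and_ne_zero (hF : NontrivialMeromorphic F) (z : ℂ) :
    ∀ᶠ w in 𝓝[≠] z, ¬ meromorphicOrderAt F w < 0 ∧ F w ≠ 0 := by
  filter_upwards [(hF.nfAt z).meromorphicAt.eventually_analyticAt,
    (meromorphicOrderAt_ne_top_iff_eventually_ne_zero (hF.nfAt z).meromorphicAt).mp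
      (hF.order_ne_top z)] with w h1 h2
  exact ⟨not_pole_of_analyticAt h1, h2⟩

end NontrivialMeromorphic

lemma continuous_stereo_coe : Continuous fun a : ℂ => stereo (a : OnePoint ℂ) := by
  refine (LipschitzWith.of_dist_le_mul (K := 1) fun a b => ?_).continuous
  rw [dist_stereo, NNReal.coe_one, one_mul, dist_eq_norm]
  exact chordalDist_coe_le a b

lemma continuous_stereo_sphereInv_coe :
    Continuous fun a : ℂ => stereo (sphereInv (a : OnePoint ℂ)) := by
  refine (LipschitzWith.of_dist_le_mul (K := 1) fun a b => ?_).continuous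
  rw [dist_stereo, chordalDist_sphereInv, NNReal.coe_one, one_mul, dist_eq_norm]
  exact chordalDist_coe_le a b

open Classical in
/-- The product of a non-zero scalar and a meromorphic function, as a map into the sphere, is
jointly continuous. -/
lemma NontrivialMeromorphic.continuousAt_scaled {D : ℂ → ℂ} (hD : NontrivialMeromorphic D)
    {s : ℂ} (hs : s ≠ 0) (w : ℂ) :
    ContinuousAt (fun q : ℂ × ℂ => stereo (if meromorphicOrderAt D q.2 < 0 then OnePoint.infty
      else ((q.1 * D q.2 : ℂ) : OnePoint ℂ))) (s, w) := by
  have hsnd : Tendsto (Prod.snd : ℂ × ℂ → ℂ) (𝓝 (s, w)) (𝓝 w) := continuous_snd.continuousAt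
  have hfst : Tendsto (Prod.fst : ℂ × ℂ → ℂ) (𝓝 (s, w)) (𝓝 s) := continuous_fst.continuousAt
  by_cases hw : meromorphicOrderAt D w < 0
  · have hE := hD.analyticAt_inv_of_pole hw
    have hc : ContinuousAt (fun q : ℂ × ℂ => stereo (sphereInv ((q.1⁻¹ * D⁻¹ q.2 : ℂ)))) (s, w) := by
      refine continuous_stereo_sphereInv_coe.continuousAt.comp
        (f := fun q : ℂ × ℂ => q.1⁻¹ * D⁻¹ q.2) ?_
      refine (continuousAt_fst.inv₀ hs).mul ?_
      exact ContinuousAt.comp' (g := D⁻¹) hE.continuousAt continuousAt_snd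
    refine hc.congr ?_
    have h1 := hD.eventually_not_pole_and_ne_zero w
    rw [eventually_nhdsWithin_iff] at h1
    filter_upwards [hsnd.eventually h1, hfst.eventually_ne hs] with q hq hq1
    by_cases hqw : q.2 = w
    · rw [hqw, if_pos hw, Pi.inv_apply, eq_zero_of_pole (hD.nfAt w) hw, inv_zero, mul_zero,
        sphereInv_zero]
    · obtain ⟨h2, h3⟩ := hq hqw
      rw [if_neg h2, Pi.inv_apply, ← mul_inv, sphereInv_coe (inv_ne_zero (mul_ne_zero hq1 h3)),
        inv_inv]
  · have hE := analyticAt_of_not_pole (hD.nfAt w) hw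
    have hc : ContinuousAt (fun q : ℂ × ℂ => stereo ((q.1 * D q.2 : ℂ))) (s, w) := by
      refine continuous_stereo_coe.continuousAt.comp (f := fun q : ℂ × ℂ => q.1 * D q.2) ?_
      refine continuousAt_fst.mul ?_
      exact ContinuousAt.comp' (g := D) hE.continuousAt continuousAt_snd
    refine hc.congr ?_
    filter_upwards [hsnd.eventually hE.eventually_analyticAt] with q hq
    rw [if_neg (not_pole_of_analyticAt hq)]

lemma NontrivialMeromorphic.continuous_sphereValue {F : ℂ → ℂ} (hF : NontrivialMeromorphic F) :
    Continuous fun z => stereo (sphereValue F z) := by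
  rw [continuous_iff_continuousAt]
  intro z
  have h := ContinuousAt.comp' (f := fun z : ℂ => ((1 : ℂ), z)) (hF.continuousAt_scaled one_ne_zero z)
    (by fun_prop)
  simpa only [one_mul, sphereValue] using h

/-! ### Holomorphic description of spherical limits -/

lemma continuous_of_tendstoSpherically {F : ℕ → ℂ → ℂ} (hF : ∀ n, NontrivialMeromorphic (F n))
    {g : ℂ → OnePoint ℂ} (h : TendstoSpherically (fun n => sphereValue (F n)) g) :
    Continuous fun z => stereo (g z) :=
  (tendstoSpherically_iff.mp h).continuous
    (Frequently.of_forall fun n => (hF n).continuous_sphereValue)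

/-- The limit is continuous, hence bounded near a point where it is finite. On bounded values the
chordal and Euclidean metrics are uniformly equivalent, so the approximants eventually have no poles
there. -/
lemma exists_analytic_limit {F : ℕ → ℂ → ℂ} (hF : ∀ n, NontrivialMeromorphic (F n))
    {g : ℂ → OnePoint ℂ} (h : TendstoSpherically (fun n => sphereValue (F n)) g) {z₀ : ℂ}
    (hz₀ : g z₀ ≠ OnePoint.infty) :
    ∃ r > 0, ∃ G : ℂ → ℂ, (∀ z ∈ ball z₀ r, g z = (G z : OnePoint ℂ)) ∧
      TendstoUniformlyOn F G atTop (ball z₀ r) ∧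
      ∀ᶠ n in atTop, ∀ z ∈ ball z₀ r, AnalyticAt ℂ (F n) z := by
  have hc := continuous_of_tendstoSpherically hF h
  obtain ⟨b, hb⟩ := OnePoint.ne_infty_iff_exists.mp hz₀
  obtain ⟨η, hη, hη'⟩ := exists_coe_of_chordalDist_lt ‖b‖ one_pos
  have hnear : ∀ᶠ z in 𝓝 z₀, chordalDist (g z) b < η := by
    have := Metric.tendsto_nhds.mp (hc.continuousAt (x := z₀)).tendsto η hη
    simpa only [dist_stereo, ← hb] using this
  obtain ⟨r, hr, hball⟩ := Metric.eventually_nhds_iff_ball.mp hnear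
  have hG : ∀ z, ∃ a : ℂ, z ∈ ball z₀ r → g z = a ∧ ‖a - b‖ < 1 := by
    intro z
    by_cases hz : z ∈ ball z₀ r
    · obtain ⟨a, ha⟩ := hη' (g z) b le_rfl (hball z hz)
      exact ⟨a, fun _ => ha⟩
    · exact ⟨0, fun h => absurd h hz⟩
  choose G hG using hG
  have key : ∀ ε > 0, ∀ᶠ n in atTop, ∀ z ∈ ball z₀ (r / 2),
      ¬ meromorphicOrderAt (F n) z < 0 ∧ ‖F n z - G z‖ < ε := by
    intro ε hε
    obtain ⟨η₂, hη₂, hη₂'⟩ := exists_coe_of_chordalDist_lt (‖b‖ + 1) hε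
    filter_upwards [h (closedBall z₀ (r / 2)) (isCompact_closedBall _ _) η₂ hη₂] with n hn z hz
    have hz2 : z ∈ ball z₀ r := ball_subset_ball (by linarith) hz
    obtain ⟨h1, h2⟩ := hG z hz2
    have h3 : ‖G z‖ ≤ ‖b‖ + 1 := by
      have := norm_add_le (G z - b) b
      rw [sub_add_cancel] at this
      linarith
    have h4 := hn z (ball_subset_closedBall hz)
    rw [h1] at h4
    obtain ⟨a, ha1, ha2⟩ := hη₂' _ _ h3 h4
    have h5 : ¬ meromorphicOrderAt (F n) z < 0 := by
      rw [← sphereValue_eq_infty_iff, ha1]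
      exact OnePoint.coe_ne_infty a
    rw [sphereValue_of_not_pole h5, OnePoint.coe_eq_coe] at ha1
    exact ⟨h5, ha1 ▸ ha2⟩
  refine ⟨r / 2, half_pos hr, G, fun z hz => (hG z (ball_subset_ball (by linarith) hz)).1, ?_, ?_⟩
  · rw [Metric.tendstoUniformlyOn_iff]
    intro ε hε
    filter_upwards [key ε hε] with n hn z hz
    rw [dist_comm, dist_eq_norm]
    exact (hn z hz).2
  · filter_upwards [key 1 one_pos] with n hn z hz
    exact analyticAt_of_not_pole ((hF n).nfAt z) (hn z hz).1

lemma tendstoSpherically_inv {F : ℕ → ℂ → ℂ} (hF : ∀ n, NontrivialMeromorphic (F n))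
    {g : ℂ → OnePoint ℂ} (h : TendstoSpherically (fun n => sphereValue (F n)) g) :
    TendstoSpherically (fun n => sphereValue (F n)⁻¹) (fun z => sphereInv (g z)) := by
  have := h.sphereInv
  simpa only [← (hF _).sphereValue_inv] using this

/-- Local description of a spherical limit near a point where it takes the value `∞`. -/
lemma exists_analytic_limit_inv {F : ℕ → ℂ → ℂ} (hF : ∀ n, NontrivialMeromorphic (F n))
    {g : ℂ → OnePoint ℂ} (h : TendstoSpherically (fun n => sphereValue (F n)) g) {z₀ : ℂ}
    (hz₀ : g z₀ = OnePoint.infty) :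
    ∃ r > 0, ∃ G : ℂ → ℂ, G z₀ = 0 ∧ (∀ z ∈ ball z₀ r, g z = sphereInv (G z : OnePoint ℂ)) ∧
      TendstoUniformlyOn (fun n => (F n)⁻¹) G atTop (ball z₀ r) ∧
      ∀ᶠ n in atTop, ∀ z ∈ ball z₀ r, AnalyticAt ℂ (F n)⁻¹ z := by
  obtain ⟨r, hr, G, h1, h2, h3⟩ := exists_analytic_limit (fun n => (hF n).inv)
    (tendstoSpherically_inv hF h) (z₀ := z₀)
    (by rw [hz₀, sphereInv_infty]; exact OnePoint.coe_ne_infty _)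
  refine ⟨r, hr, G, ?_, fun z hz => ?_, h2, h3⟩
  · have := h1 z₀ (mem_ball_self hr)
    rw [hz₀, sphereInv_infty, OnePoint.coe_eq_coe] at this
    exact this.symm
  · rw [← h1 z hz, sphereInv_sphereInv]

lemma analyticOnNhd_limit {F : ℕ → ℂ → ℂ} {G : ℂ → ℂ} {z₀ : ℂ} {r : ℝ}
    (h : TendstoUniformlyOn F G atTop (ball z₀ r))
    (hd : ∀ᶠ n in atTop, ∀ z ∈ ball z₀ r, AnalyticAt ℂ (F n) z) :
    AnalyticOnNhd ℂ G (ball z₀ r) :=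
  (h.tendstoLocallyUniformlyOn.differentiableOn (hd.mono fun _ hn z hz =>
    (hn z hz).differentiableAt.differentiableWithinAt) isOpen_ball).analyticOnNhd isOpen_ball

/-- A spherical limit that takes the value `∞` on some open set is identically `∞`. -/
lemma eq_infty_of_eventually {F : ℕ → ℂ → ℂ} (hF : ∀ n, NontrivialMeromorphic (F n))
    {g : ℂ → OnePoint ℂ} (h : TendstoSpherically (fun n => sphereValue (F n)) g) {z₀ : ℂ}
    (hz₀ : ∀ᶠ z in 𝓝 z₀, g z = OnePoint.infty) (z : ℂ) : g z = OnePoint.infty := by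
  have hc := continuous_of_tendstoSpherically hF h
  let S : Set ℂ := {w | ∀ᶠ z in 𝓝 w, g z = OnePoint.infty}
  have hopen : IsOpen S := isOpen_setOfPred_eventually_nhds
  -- At a limit point `w` of `S` the reciprocals converge to a holomorphic function that vanishes on
  -- an open subset of a disc about `w`; the identity theorem makes it vanish on the whole disc.
  have hclosed : IsClosed S := by
    rw [← closure_subset_iff_isClosed]
    intro w hw
    have hgw : g w = OnePoint.infty := by
      have hcl : IsClosed {z | stereo (g z) = stereo OnePoint.infty} :=
        isClosed_eq hc continuous_const
      refine stereo_injective (closure_minimal ?_ hcl hw)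
      intro y hy
      exact congrArg stereo hy.self_of_nhds
    obtain ⟨r, hr, G, hG0, hG1, hG2, hG3⟩ := exists_analytic_limit_inv hF h hgw
    have han := analyticOnNhd_limit hG2 hG3
    obtain ⟨y, hyb, hyS⟩ := mem_closure_iff.mp hw (ball w r) isOpen_ball (mem_ball_self hr)
    have hGy : G =ᶠ[𝓝 y] 0 := by
      filter_upwards [hyS, isOpen_ball.mem_nhds hyb] with z hz hzb
      have h1 := hG1 z hzb
      rw [hz] at h1
      by_contra hne
      rw [sphereInv_coe hne] at h1
      exact OnePoint.coe_ne_infty _ h1.symm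
    have hG := han.eqOn_zero_of_preconnected_of_eventuallyEq_zero
      (convex_ball w r).isPreconnected hyb hGy
    refine Filter.mem_of_superset (isOpen_ball.mem_nhds (mem_ball_self hr)) fun z hz => ?_
    change g z = _
    have : G z = 0 := hG hz
    rw [hG1 z hz, this, sphereInv_zero]
  have huniv : S = univ := IsClopen.eq_univ ⟨hclosed, hopen⟩ ⟨z₀, hz₀⟩
  have hz : z ∈ S := huniv ▸ mem_univ z
  exact hz.self_of_nhds

/-! ### Derivatives -/

lemma meromorphicOrderAt_deriv_lt_zero {F : ℂ → ℂ} {z : ℂ} (hz : meromorphicOrderAt F z < 0) :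
    meromorphicOrderAt (deriv F) z < 0 := by
  lift meromorphicOrderAt F z to ℤ using hz.ne_top with n hn
  have hn0 : n < 0 := by exact_mod_cast hz
  rw [meromorphicOrderAt_deriv_eq_sub_one (Int.cast_ne_zero.mpr hn0.ne) hn.symm]
  exact_mod_cast (by omega : n - 1 < 0)

/-- `F` is unbounded near a pole, hence not differentiable there, and `deriv` takes its default
value `0`. This is the value that the normal form prescribes, so `deriv F` needs no correction; it
also makes poles of `F` zeros of the function `deriv F`. -/
lemma deriv_eq_zero_of_pole {F : ℂ → ℂ} {z : ℂ} (hz : meromorphicOrderAt F z < 0) :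
    deriv F z = 0 := by
  refine deriv_zero_of_not_differentiableAt fun hd => ?_
  have h1 := tendsto_norm_atTop_iff_cobounded.mpr (tendsto_cobounded_of_meromorphicOrderAt_neg hz)
  have h2 : Tendsto (fun w => ‖F w‖) (𝓝[≠] z) (𝓝 ‖F z‖) :=
    (hd.continuousAt.tendsto.mono_left nhdsWithin_le_nhds).norm
  exact not_tendsto_nhds_of_tendsto_atTop h1 _ h2

lemma meromorphicNFAt_deriv {F : ℂ → ℂ} {z : ℂ} (hF : MeromorphicNFAt F z) :
    MeromorphicNFAt (deriv F) z := by
  rw [meromorphicNFAt_iff_analyticAt_or]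
  by_cases hz : meromorphicOrderAt F z < 0
  · exact Or.inr ⟨hF.meromorphicAt.deriv, meromorphicOrderAt_deriv_lt_zero hz,
      deriv_eq_zero_of_pole hz⟩
  · exact Or.inl (analyticAt_of_not_pole hF hz).deriv

lemma deriv_pole_iff {F : ℂ → ℂ} {z : ℂ} (hF : MeromorphicNFAt F z) :
    meromorphicOrderAt (deriv F) z < 0 ↔ meromorphicOrderAt F z < 0 := by
  refine ⟨fun h => ?_, meromorphicOrderAt_deriv_lt_zero⟩
  by_contra hz
  exact not_pole_of_analyticAt (analyticAt_of_not_pole hF hz).deriv h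

/-- With `K = 1 / F` this is `1 / F' = -K² / K'`. The default values make it hold without exception:
at a pole of `F` both sides are `0`, and at a critical point both divisions are by zero. -/
lemma NontrivialMeromorphic.inv_deriv_eq {F : ℂ → ℂ} (hF : NontrivialMeromorphic F) {z : ℂ}
    (hz : AnalyticAt ℂ F⁻¹ z) : (deriv F)⁻¹ z = -(F⁻¹ z) ^ 2 / deriv F⁻¹ z := by
  by_cases h0 : F⁻¹ z = 0
  · have hFz : F z = 0 := by simpa using h0
    have hp : meromorphicOrderAt F z < 0 := by
      by_contra h
      exact not_pole_of_analyticAt hz (hF.pole_inv_iff.mpr ⟨h, hFz⟩)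
    rw [h0, Pi.inv_apply, deriv_eq_zero_of_pole hp]
    simp
  · have h1 : deriv F z = -deriv F⁻¹ z / (F⁻¹ z) ^ 2 := by
      rw [← deriv_inv'' hz.differentiableAt h0, inv_inv]
    rw [Pi.inv_apply, h1, inv_div, div_neg, neg_div]

lemma meromorphicNFOn_univ_eq_zero {F : ℂ → ℂ} (hF : MeromorphicNFOn F univ) {z₀ : ℂ}
    (h : meromorphicOrderAt F z₀ = ⊤) (z : ℂ) : F z = 0 := by
  by_contra hz
  have h1 := (hF (mem_univ z)).meromorphicOrderAt_eq_zero_iff.mpr hz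
  refine hF.meromorphicOn.meromorphicOrderAt_ne_top_of_isPreconnected isPreconnected_univ
    (mem_univ z) (mem_univ z₀) ?_ h
  rw [h1]
  exact WithTop.coe_ne_top

lemma IsTranscendentalMeromorphic.nontrivialMeromorphic {f : ℂ → ℂ}
    (hf : IsTranscendentalMeromorphic f) : NontrivialMeromorphic f where
  nf := hf.1
  order_ne_top z hz := hf.2 ⟨0, 1, one_ne_zero, fun w _ => by
    simp [meromorphicNFOn_univ_eq_zero hf.1 hz w]⟩

/-! ### Convergence across a puncture, and Hurwitz' theorem -/

/-- Locally uniform convergence of holomorphic functions on a punctured disc to a function with a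
removable singularity extends over the puncture. -/
lemma tendstoUniformlyOn_of_punctured {K : ℕ → ℂ → ℂ} {k : ℂ → ℂ} {z₀ c : ℂ} {ρ : ℝ} (hρ : 0 < ρ)
    (hd : ∀ᶠ n in atTop, DifferentiableOn ℂ (K n) (ball z₀ ρ))
    (hk : TendstoLocallyUniformlyOn K k atTop (ball z₀ ρ \ {z₀}))
    (hc : Tendsto k (𝓝[≠] z₀) (𝓝 c)) :
    TendstoUniformlyOn K (Function.update k z₀ c) atTop (closedBall z₀ (ρ / 2)) := by
  have hρ2 : 0 < ρ / 2 := half_pos hρ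
  have hcb : closedBall z₀ (ρ / 2) ⊆ ball z₀ ρ := closedBall_subset_ball (by linarith)
  have hsp : sphere z₀ (ρ / 2) ⊆ ball z₀ ρ \ {z₀} := fun z hz =>
    ⟨hcb (sphere_subset_closedBall hz), ne_of_mem_sphere hz hρ2.ne'⟩
  have hopen : IsOpen (ball z₀ ρ \ {z₀}) := isOpen_ball.sdiff isClosed_singleton
  have hS : TendstoUniformlyOn K k atTop (sphere z₀ (ρ / 2)) :=
    (tendstoLocallyUniformlyOn_iff_forall_isCompact hopen).mp hk _ hsp (isCompact_sphere _ _)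
  have hC : UniformCauchySeqOn K atTop (closedBall z₀ (ρ / 2)) := by
    rw [Metric.uniformCauchySeqOn_iff]
    intro ε hε
    obtain ⟨N₁, hN₁⟩ := Metric.uniformCauchySeqOn_iff.mp hS.uniformCauchySeqOn (ε / 2) (half_pos hε)
    obtain ⟨N₂, hN₂⟩ := eventually_atTop.mp hd
    refine ⟨max N₁ N₂, fun m hm n hn z hz => ?_⟩
    have hdm := hN₂ m (le_of_max_le_right hm)
    have hdn := hN₂ n (le_of_max_le_right hn)
    have hdiff : DiffContOnCl ℂ (fun w => K m w - K n w) (ball z₀ (ρ / 2)) := by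
      refine DifferentiableOn.diffContOnCl ((hdm.sub hdn).mono ?_)
      rwa [closure_ball _ hρ2.ne']
    -- The maximum principle for `K m - K n` carries the Cauchy property from the circle, where
    -- convergence is known, to the disc including its centre.
    have := Complex.norm_le_of_forall_mem_frontier_norm_le isBounded_ball hdiff (C := ε / 2)
      (fun w hw => by
        rw [frontier_ball _ hρ2.ne'] at hw
        rw [← dist_eq_norm]
        exact (hN₁ m (le_of_max_le_left hm) n (le_of_max_le_left hn) w hw).le)
      (z := z) (by rwa [closure_ball _ hρ2.ne'])
    rw [dist_eq_norm]
    linarith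
  have hlim : ∀ z, ∃ a, z ∈ closedBall z₀ (ρ / 2) → Tendsto (fun n => K n z) atTop (𝓝 a) := by
    intro z
    by_cases hz : z ∈ closedBall z₀ (ρ / 2)
    · obtain ⟨a, ha⟩ := cauchySeq_tendsto_of_complete (hC.cauchySeq hz)
      exact ⟨a, fun _ => ha⟩
    · exact ⟨0, fun h => absurd h hz⟩
  choose k' hk' using hlim
  have hU : TendstoUniformlyOn K k' atTop (closedBall z₀ (ρ / 2)) :=
    hC.tendstoUniformlyOn_of_tendsto hk'
  have heq : ∀ z ∈ closedBall z₀ (ρ / 2), z ≠ z₀ → k' z = k z := fun z hz hne =>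
    tendsto_nhds_unique (hk' z hz) (hk.tendsto_at ⟨hcb hz, hne⟩)
  have hcont : ContinuousOn k' (closedBall z₀ (ρ / 2)) :=
    hU.continuousOn (hd.mono fun n hn => hn.continuousOn.mono hcb).frequently
  have hnhds : closedBall z₀ (ρ / 2) ∈ 𝓝 z₀ := closedBall_mem_nhds _ hρ2
  have h0 : k' z₀ = c := by
    have h1 : Tendsto k' (𝓝[≠] z₀) (𝓝 (k' z₀)) :=
      (hcont.continuousAt hnhds).tendsto.mono_left nhdsWithin_le_nhds
    refine tendsto_nhds_unique h1 (hc.congr' ?_)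
    filter_upwards [self_mem_nhdsWithin, mem_nhdsWithin_of_mem_nhds hnhds] with z hz hzb
    exact (heq z hzb hz).symm
  refine hU.congr_right fun z hz => ?_
  by_cases hne : z = z₀
  · rw [hne, h0, Function.update_self]
  · rw [heq z hz hne, Function.update_of_ne hne]

lemma tendsto_of_punctured {K : ℕ → ℂ → ℂ} {k : ℂ → ℂ} {z₀ c : ℂ} {ρ : ℝ} (hρ : 0 < ρ)
    (hd : ∀ᶠ n in atTop, DifferentiableOn ℂ (K n) (ball z₀ ρ))
    (hk : TendstoLocallyUniformlyOn K k atTop (ball z₀ ρ \ {z₀}))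
    (hc : Tendsto k (𝓝[≠] z₀) (𝓝 c)) {w : ℕ → ℂ} (hw : Tendsto w atTop (𝓝 z₀)) :
    Tendsto (fun n => K n (w n)) atTop (𝓝 c) := by
  have hnhds : closedBall z₀ (ρ / 2) ∈ 𝓝 z₀ := closedBall_mem_nhds _ (half_pos hρ)
  have h := (tendstoUniformlyOn_of_punctured hρ hd hk hc).tendsto_comp (x := z₀) (g := w)
    (continuousAt_update_same.mpr hc).continuousWithinAt
    (tendsto_nhdsWithin_iff.mpr ⟨hw, hw.eventually hnhds⟩)
  rwa [Function.update_self] at h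

/-- Hurwitz: a zero of a nontrivial limit attracts zeros of the approximating functions. -/
lemma eventually_exists_zero {K : ℕ → ℂ → ℂ} {k : ℂ → ℂ} {z₀ : ℂ} {r : ℝ} (hr : 0 < r)
    (hK : TendstoUniformlyOn K k atTop (ball z₀ r))
    (hd : ∀ᶠ n in atTop, ∀ z ∈ ball z₀ r, AnalyticAt ℂ (K n) z) (h0 : k z₀ = 0)
    (hne : ∀ᶠ z in 𝓝[≠] z₀, k z ≠ 0) : ∀ᶠ n in atTop, ∃ z ∈ ball z₀ r, K n z = 0 := by
  rw [eventually_nhdsWithin_iff, Metric.eventually_nhds_iff_ball] at hne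
  obtain ⟨ρ, hρ, hne⟩ := hne
  set s := min ρ r / 2
  have hs : 0 < s := by positivity
  have hsr : s < r := by have := min_le_right ρ r; simp only [s]; linarith [lt_min hρ hr]
  have hsρ : s < ρ := by have := min_le_left ρ r; simp only [s]; linarith [lt_min hρ hr]
  have hcont : ContinuousOn k (sphere z₀ s) :=
    (analyticOnNhd_limit hK hd).continuousOn.mono
      (sphere_subset_closedBall.trans (closedBall_subset_ball hsr))
  obtain ⟨z₁, hz₁, hmin⟩ := (isCompact_sphere z₀ s).exists_isMinOn
    (NormedSpace.sphere_nonempty.mpr hs.le) hcont.norm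
  have hε : 0 < ‖k z₁‖ := norm_pos_iff.mpr
    (hne z₁ (closedBall_subset_ball hsρ (sphere_subset_closedBall hz₁))
      (ne_of_mem_sphere hz₁ hs.ne'))
  filter_upwards [hd, Metric.tendstoUniformlyOn_iff.mp hK (‖k z₁‖ / 3) (by positivity)] with n h1 h2
  by_contra! hzero
  have hsub : closedBall z₀ s ⊆ ball z₀ r := closedBall_subset_ball hsr
  have hdiff : DiffContOnCl ℂ (fun z => (K n z)⁻¹) (ball z₀ s) := by
    refine DifferentiableOn.diffContOnCl ?_
    rw [closure_ball _ hs.ne']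
    intro z hz
    exact ((h1 z (hsub hz)).differentiableAt.inv (hzero z (hsub hz))).differentiableWithinAt
  -- With `μ = ‖k z₁‖` the minimum of `‖k‖` on the circle, `‖K n‖ ≥ 2μ/3` on the circle but `‖K n
  -- z₀‖ < μ/3`. For a zero-free `K n` this contradicts the maximum principle for `1 / K n`.
  have hmax := Complex.norm_le_of_forall_mem_frontier_norm_le isBounded_ball hdiff
    (C := (2 * ‖k z₁‖ / 3)⁻¹) (fun w hw => by
        rw [frontier_ball _ hs.ne'] at hw
        rw [norm_inv]
        have h3 := h2 w (hsub (sphere_subset_closedBall hw))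
        have h4 : ‖k z₁‖ ≤ ‖k w‖ := hmin hw
        rw [dist_eq_norm] at h3
        have h5 := norm_sub_norm_le (k w) (K n w)
        exact inv_anti₀ (by positivity) (by linarith))
    (z := z₀) (subset_closure (mem_ball_self hs))
  have h3 := h2 z₀ (mem_ball_self hr)
  rw [h0, dist_zero_left] at h3
  rw [norm_inv] at hmax
  have h4 := (inv_le_inv₀ (norm_pos_iff.mpr (hzero z₀ (mem_ball_self hr))) (by positivity)).mp hmax
  linarith

/-! ### Logarithmic derivatives and merging zeros -/

/-- At a zero of `h` of any multiplicity the logarithmic derivative has a simple pole, so its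
reciprocal has a simple zero; the quotient also has the value `0` there, even when `deriv h a = 0`.
-/
lemma analyticAt_inv_logDeriv {h : ℂ → ℂ} {a : ℂ} (hh : AnalyticAt ℂ h a)
    (htop : meromorphicOrderAt h a ≠ ⊤) (hcrit : deriv h a = 0 → h a = 0) :
    AnalyticAt ℂ (fun z => h z / deriv h z) a := by
  by_cases h0 : h a = 0
  · have hord : meromorphicOrderAt h a ≠ 0 := fun h1 =>
      hh.meromorphicNFAt.meromorphicOrderAt_eq_zero_iff.mp h1 h0
    have h1 := meromorphicOrderAt_logDeriv_eq_neg_one hh.meromorphicAt hord htop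
    have h2 : (fun z => h z / deriv h z) = (logDeriv h)⁻¹ := by
      funext z
      simp [logDeriv_apply]
    refine AnalyticAt.of_meromorphicOrderAt_pos ?_ (by simp [h0])
    rw [h2, meromorphicOrderAt_inv, h1]
    norm_num
  · exact hh.div hh.deriv fun h1 => h0 (hcrit h1)

lemma meromorphicOrderAt_sub_mul_logDeriv {h : ℂ → ℂ} {a : ℂ} (hh : AnalyticAt ℂ h a)
    (htop : meromorphicOrderAt h a ≠ ⊤) (h0 : h a = 0) :
    meromorphicOrderAt (fun z => (z - a) * (deriv h z / h z)) a = 0 := by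
  have hord : meromorphicOrderAt h a ≠ 0 := fun h1 =>
    hh.meromorphicNFAt.meromorphicOrderAt_eq_zero_iff.mp h1 h0
  have h1 := meromorphicOrderAt_logDeriv_eq_neg_one hh.meromorphicAt hord htop
  have h2 : (fun z => (z - a) * (deriv h z / h z)) = (fun z => z - a) * logDeriv h := by
    funext z
    simp [logDeriv_apply]
  have h3 : meromorphicOrderAt (fun z => z - a) a = 1 := meromorphicOrderAt_id_sub_const
  have h4 : MeromorphicAt (logDeriv h) a := hh.meromorphicAt.deriv.div hh.meromorphicAt
  rw [h2, meromorphicOrderAt_mul (by fun_prop) h4, h1, h3]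
  rfl

/-- A single factor `z - p` already removes the pole, but at a zero `p` of `h` the formula then
evaluates to `0` instead of the multiplicity. The second factor makes `0` the correct value; it is
divided out again by `dslope` at `p`, which fills in the right value. -/
lemma analyticAt_sq_mul_logDeriv {h : ℂ → ℂ} {a p : ℂ} (hh : AnalyticAt ℂ h a)
    (htop : meromorphicOrderAt h a ≠ ⊤) (hzero : h a = 0 → a = p) :
    AnalyticAt ℂ (fun z => (z - p) * ((z - p) * (deriv h z / h z))) a := by
  by_cases h0 : h a = 0
  · obtain rfl := hzero h0
    have h1 := meromorphicOrderAt_sub_mul_logDeriv hh htop h0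
    have h3 : meromorphicOrderAt (fun z => z - a) a = 1 := meromorphicOrderAt_id_sub_const
    refine AnalyticAt.of_meromorphicOrderAt_pos ?_ (by simp)
    have h4 : MeromorphicAt (fun z => (z - a) * (deriv h z / h z)) a :=
      MeromorphicAt.mul (by fun_prop) (hh.meromorphicAt.deriv.div hh.meromorphicAt)
    have h5 := meromorphicOrderAt_mul (f := fun z => z - a) (by fun_prop) h4
    rw [h1, h3] at h5
    change 0 < meromorphicOrderAt ((fun z => z - a) * fun z => (z - a) * (deriv h z / h z)) a
    rw [h5]
    norm_num
  · exact (by fun_prop : AnalyticAt ℂ (fun z => z - p) a).mul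
      ((by fun_prop : AnalyticAt ℂ (fun z => z - p) a).mul (hh.deriv.div hh h0))

lemma exists_ball_ne_zero {h : ℂ → ℂ} {a : ℂ} (hh : AnalyticAt ℂ h a)
    (htop : meromorphicOrderAt h a ≠ ⊤) (h0 : h a = 0) {r : ℝ} (hr : 0 < r) :
    ∃ ρ > 0, ρ ≤ r ∧ ∀ z ∈ ball a ρ \ {a}, h z ≠ 0 ∧ deriv h z ≠ 0 := by
  have hd : meromorphicOrderAt (deriv h) a ≠ ⊤ := by
    have hord : meromorphicOrderAt h a ≠ 0 := fun h1 =>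
      hh.meromorphicNFAt.meromorphicOrderAt_eq_zero_iff.mp h1 h0
    lift meromorphicOrderAt h a to ℤ using htop with n hn
    rw [meromorphicOrderAt_deriv_eq_sub_one (Int.cast_ne_zero.mpr (by exact_mod_cast hord)) hn.symm]
    exact WithTop.coe_ne_top
  have h1 := (meromorphicOrderAt_ne_top_iff_eventually_ne_zero hh.meromorphicAt).mp htop
  have h2 := (meromorphicOrderAt_ne_top_iff_eventually_ne_zero hh.meromorphicAt.deriv).mp hd
  have h3 := h1.and h2
  rw [eventually_nhdsWithin_iff, Metric.eventually_nhds_iff_ball] at h3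
  obtain ⟨ρ, hρ, h3⟩ := h3
  exact ⟨min ρ r, lt_min hρ hr, min_le_right _ _,
    fun z hz => h3 z (ball_subset_ball (min_le_left _ _) hz.1) hz.2⟩

/-- Congruence of a locally uniformly convergent sequence on a punctured disc, off a sequence of
points tending to the puncture. -/
lemma TendstoLocallyUniformlyOn.congr_off {K K' : ℕ → ℂ → ℂ} {k : ℂ → ℂ} {z₀ : ℂ} {ρ : ℝ}
    (hk : TendstoLocallyUniformlyOn K k atTop (ball z₀ ρ \ {z₀})) {p : ℕ → ℂ}
    (hp : Tendsto p atTop (𝓝 z₀))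
    (heq : ∀ᶠ n in atTop, ∀ z ∈ ball z₀ ρ, z ≠ p n → K n z = K' n z) :
    TendstoLocallyUniformlyOn K' k atTop (ball z₀ ρ \ {z₀}) := by
  have hopen : IsOpen (ball z₀ ρ \ {z₀}) := isOpen_ball.sdiff isClosed_singleton
  rw [tendstoLocallyUniformlyOn_iff_forall_isCompact hopen] at hk ⊢
  intro S hS hSc
  refine (hk S hS hSc).congr ?_
  have hmem : Sᶜ ∈ 𝓝 z₀ := hSc.isClosed.isOpen_compl.mem_nhds fun h => (hS h).2 rfl
  filter_upwards [heq, hp.eventually hmem] with n hn hpn z hz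
  exact hn z (hS hz).1 fun h => hpn (h ▸ hz)

/-- Holomorphic functions `K n` converge near `z₀` to a nontrivial function `k` that vanishes at
`z₀`. -/
structure ZeroLimit (K : ℕ → ℂ → ℂ) (k : ℂ → ℂ) (z₀ : ℂ) (r : ℝ) : Prop where
  pos : 0 < r
  tendsto : TendstoUniformlyOn K k atTop (ball z₀ r)
  analytic : ∀ᶠ n in atTop, ∀ z ∈ ball z₀ r, AnalyticAt ℂ (K n) z
  order_ne_top : ∀ n z, meromorphicOrderAt (K n) z ≠ ⊤
  apply_eq_zero : k z₀ = 0
  limit_order_ne_top : meromorphicOrderAt k z₀ ≠ ⊤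

namespace ZeroLimit

variable {K : ℕ → ℂ → ℂ} {k : ℂ → ℂ} {z₀ : ℂ} {r : ℝ}

lemma mono (h : ZeroLimit K k z₀ r) {s : ℝ} (hs : 0 < s) (hsr : s ≤ r) : ZeroLimit K k z₀ s where
  pos := hs
  tendsto := h.tendsto.mono (ball_subset_ball hsr)
  analytic := h.analytic.mono fun _ hn z hz => hn z (ball_subset_ball hsr hz)
  order_ne_top := h.order_ne_top
  apply_eq_zero := h.apply_eq_zero
  limit_order_ne_top := h.limit_order_ne_top

lemma analyticOnNhd (h : ZeroLimit K k z₀ r) : AnalyticOnNhd ℂ k (ball z₀ r) :=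
  analyticOnNhd_limit h.tendsto h.analytic

lemma analyticAt (h : ZeroLimit K k z₀ r) : AnalyticAt ℂ k z₀ :=
  h.analyticOnNhd z₀ (mem_ball_self h.pos)

lemma exists_nice (h : ZeroLimit K k z₀ r) : ∃ ρ ≤ r, ZeroLimit K k z₀ ρ ∧
    ∀ z ∈ ball z₀ ρ \ {z₀}, k z ≠ 0 ∧ deriv k z ≠ 0 := by
  obtain ⟨ρ, hρ, hρr, hne⟩ :=
    exists_ball_ne_zero h.analyticAt h.limit_order_ne_top h.apply_eq_zero h.pos
  exact ⟨ρ, hρr, h.mono hρ hρr, hne⟩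

lemma tendsto_deriv (h : ZeroLimit K k z₀ r) :
    TendstoLocallyUniformlyOn (fun n z => deriv (K n) z) (deriv k) atTop (ball z₀ r \ {z₀}) :=
  (h.tendsto.tendstoLocallyUniformlyOn.deriv (h.analytic.mono fun _ hn z hz =>
    (hn z hz).differentiableAt.differentiableWithinAt) isOpen_ball).mono sdiff_subset

lemma tendsto_punctured (h : ZeroLimit K k z₀ r) :
    TendstoLocallyUniformlyOn K k atTop (ball z₀ r \ {z₀}) :=
  h.tendsto.tendstoLocallyUniformlyOn.mono sdiff_subset

lemma exists_zeros (h : ZeroLimit K k z₀ r) {s : ℝ} (hs : 0 < s) :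
    ∀ᶠ n in atTop, ∃ z ∈ ball z₀ s, K n z = 0 := by
  have h' := h.mono (lt_min hs h.pos) (min_le_right s r)
  filter_upwards [eventually_exists_zero h'.pos h'.tendsto h'.analytic h'.apply_eq_zero
    ((meromorphicOrderAt_ne_top_iff_eventually_ne_zero h.analyticAt.meromorphicAt).mp
      h.limit_order_ne_top)] with n ⟨z, hz, hz0⟩
  exact ⟨z, ball_subset_ball (min_le_left s r) hz, hz0⟩

lemma tendsto_sub {p : ℕ → ℂ} (hp : Tendsto p atTop (𝓝 z₀)) (s : Set ℂ) :
    TendstoLocallyUniformlyOn (fun n z => z - p n) (fun z => z - z₀) atTop s := by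
  refine TendstoUniformlyOn.tendstoLocallyUniformlyOn ?_
  rw [Metric.tendstoUniformlyOn_iff]
  intro ε hε
  filter_upwards [Metric.tendsto_nhds.mp hp ε hε] with n hn z _
  rw [dist_eq_norm] at hn ⊢
  simpa using hn

/-- The limit is the multiplicity of the zero of `k`; only its being nonzero matters. -/
lemma exists_tendsto_quotient (h : ZeroLimit K k z₀ r) : ∃ c ≠ 0,
    Tendsto (fun z => (z - z₀) * (deriv k z / k z)) (𝓝[≠] z₀) (𝓝 c) :=
  tendsto_ne_zero_of_meromorphicOrderAt_eq_zero
    (MeromorphicAt.mul (by fun_prop) (h.analyticAt.meromorphicAt.deriv.div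
      h.analyticAt.meromorphicAt))
    (meromorphicOrderAt_sub_mul_logDeriv h.analyticAt h.limit_order_ne_top h.apply_eq_zero)

/-- If the approximating functions have only one zero near `z₀`, then their further critical points
stay away from `z₀`. -/
lemma eq_zero_of_deriv_eq_zero (h : ZeroLimit K k z₀ r) {p : ℕ → ℂ} (hp : Tendsto p atTop (𝓝 z₀))
    (hzero : ∀ᶠ n in atTop, ∀ z ∈ ball z₀ r, K n z = 0 → z = p n)
    {c : ℕ → ℂ} (hc : Tendsto c atTop (𝓝 z₀)) :
    ∀ᶠ n in atTop, deriv (K n) (c n) = 0 → c n = p n := by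
  obtain ⟨ρ, hρr, h', hne⟩ := h.exists_nice
  -- `dslope (J n) (p n)` is the holomorphic extension of `(z - p n) (K n)' / K n` over the only
  -- possible pole `p n`.
  let J : ℕ → ℂ → ℂ := fun n z => (z - p n) * ((z - p n) * (deriv (K n) z / K n z))
  have hJ : ∀ n z, z ≠ p n → dslope (J n) (p n) z = (z - p n) * (deriv (K n) z / K n z) := by
    intro n z hz
    rw [dslope_of_ne _ hz, slope_def_field]
    simp only [J, sub_self, zero_mul, sub_zero]
    exact mul_div_cancel_left₀ _ (sub_ne_zero.mpr hz)
  have hd : ∀ᶠ n in atTop, DifferentiableOn ℂ (dslope (J n) (p n)) (ball z₀ ρ) := by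
    filter_upwards [h'.analytic, hzero, hp.eventually (isOpen_ball.mem_nhds (mem_ball_self h'.pos))]
      with n h1 h2 h3
    rw [Complex.differentiableOn_dslope (isOpen_ball.mem_nhds h3)]
    intro z hz
    exact (analyticAt_sq_mul_logDeriv (h1 z hz) (h.order_ne_top n z)
      (h2 z (ball_subset_ball hρr hz))).differentiableAt.differentiableWithinAt
  have hcont : ContinuousOn k (ball z₀ ρ \ {z₀}) := h'.analyticOnNhd.continuousOn.mono sdiff_subset
  have hcont' : ContinuousOn (deriv k) (ball z₀ ρ \ {z₀}) :=
    h'.analyticOnNhd.deriv.continuousOn.mono sdiff_subset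
  have hlim : TendstoLocallyUniformlyOn (fun n => dslope (J n) (p n))
      (fun z => (z - z₀) * (deriv k z / k z)) atTop (ball z₀ ρ \ {z₀}) := by
    refine TendstoLocallyUniformlyOn.congr_off ((tendsto_sub hp _).fun_mul₀
      (h'.tendsto_deriv.fun_div₀ h'.tendsto_punctured hcont' hcont fun z hz => (hne z hz).1)
      (by fun_prop) (hcont'.div hcont fun z hz => (hne z hz).1)) hp
      (Eventually.of_forall fun n z _ hz => (hJ n z hz).symm)
  obtain ⟨a, ha, hlimit⟩ := h.exists_tendsto_quotient
  filter_upwards [(tendsto_of_punctured h'.pos hd hlim hlimit hc).eventually_ne ha] with n h1 h2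
  by_contra h3
  exact h1 (by rw [hJ n _ h3, h2, zero_div, mul_zero])

/-- If the approximating functions have no critical points near `z₀` besides their zeros, then
these zeros do not cluster. -/
lemma eq_of_zeros (h : ZeroLimit K k z₀ r) {p : ℕ → ℂ} (hp : Tendsto p atTop (𝓝 z₀))
    (hp0 : ∀ n, K n (p n) = 0)
    (hcrit : ∀ᶠ n in atTop, ∀ z ∈ ball z₀ r, deriv (K n) z = 0 → K n z = 0)
    {q : ℕ → ℂ} (hq : Tendsto q atTop (𝓝 z₀)) :
    ∀ᶠ n in atTop, K n (q n) = 0 → q n = p n := by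
  obtain ⟨ρ, hρr, h', hne⟩ := h.exists_nice
  -- `J n` is holomorphic and vanishes at every zero of `K n`. After division by `z - p n` it would
  -- still vanish at a second zero `q n`, whereas the limit at `z₀` is not zero.
  let J : ℕ → ℂ → ℂ := fun n z => K n z / deriv (K n) z
  have hJ : ∀ n z, z ≠ p n → dslope (J n) (p n) z = ((z - p n) * (deriv (K n) z / K n z))⁻¹ := by
    intro n z hz
    rw [dslope_of_ne _ hz, slope_def_field]
    simp only [J, hp0, zero_div, sub_zero]
    rw [mul_inv, inv_div, div_eq_mul_inv _ (z - p n), mul_comm]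
  have hd : ∀ᶠ n in atTop, DifferentiableOn ℂ (dslope (J n) (p n)) (ball z₀ ρ) := by
    filter_upwards [h'.analytic, hcrit, hp.eventually (isOpen_ball.mem_nhds (mem_ball_self h'.pos))]
      with n h1 h2 h3
    rw [Complex.differentiableOn_dslope (isOpen_ball.mem_nhds h3)]
    intro z hz
    exact (analyticAt_inv_logDeriv (h1 z hz) (h.order_ne_top n z)
      (h2 z (ball_subset_ball hρr hz))).differentiableAt.differentiableWithinAt
  have hcont : ContinuousOn k (ball z₀ ρ \ {z₀}) := h'.analyticOnNhd.continuousOn.mono sdiff_subset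
  have hcont' : ContinuousOn (deriv k) (ball z₀ ρ \ {z₀}) :=
    h'.analyticOnNhd.deriv.continuousOn.mono sdiff_subset
  have hlim : TendstoLocallyUniformlyOn (fun n => dslope (J n) (p n))
      (fun z => ((z - z₀) * (deriv k z / k z))⁻¹) atTop (ball z₀ ρ \ {z₀}) := by
    have hcd := hcont'.div hcont fun z hz => (hne z hz).1
    refine TendstoLocallyUniformlyOn.congr_off (((tendsto_sub hp _).fun_mul₀
      (h'.tendsto_deriv.fun_div₀ h'.tendsto_punctured hcont' hcont fun z hz => (hne z hz).1)
      (by fun_prop) hcd).fun_inv₀ (ContinuousOn.mul (by fun_prop) hcd) fun z hz =>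
        mul_ne_zero (sub_ne_zero.mpr hz.2) (div_ne_zero (hne z hz).2 (hne z hz).1)) hp
      (Eventually.of_forall fun n z _ hz => (hJ n z hz).symm)
  obtain ⟨a, ha, hlimit⟩ := h.exists_tendsto_quotient
  filter_upwards [(tendsto_of_punctured h'.pos hd hlim (hlimit.inv₀ ha) hq).eventually_ne
    (inv_ne_zero ha)] with n h1 h2
  by_contra h3
  exact h1 (by rw [hJ n _ h3, h2, div_zero, mul_zero, inv_zero])

/-- If the functions `-K n ^ 2 / (K n)'` are holomorphic near `z₀`, they converge near `z₀`. -/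
lemma exists_tendsto_sq_div (h : ZeroLimit K k z₀ r)
    (hd : ∀ᶠ n in atTop, DifferentiableOn ℂ (fun z => -(K n z) ^ 2 / deriv (K n) z) (ball z₀ r)) :
    ∃ s > 0, ∃ T : ℂ → ℂ, TendstoUniformlyOn (fun n z => -(K n z) ^ 2 / deriv (K n) z) T atTop
      (ball z₀ s) := by
  obtain ⟨ρ, hρr, h', hne⟩ := h.exists_nice
  have hcont : ContinuousOn k (ball z₀ ρ \ {z₀}) := h'.analyticOnNhd.continuousOn.mono sdiff_subset
  have hcont' : ContinuousOn (deriv k) (ball z₀ ρ \ {z₀}) :=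
    h'.analyticOnNhd.deriv.continuousOn.mono sdiff_subset
  have hlim : TendstoLocallyUniformlyOn (fun n z => -(K n z) ^ 2 / deriv (K n) z)
      (fun z => -(k z) ^ 2 / deriv k z) atTop (ball z₀ ρ \ {z₀}) := by
    have hsq := (h'.tendsto_punctured.fun_mul₀ h'.tendsto_punctured hcont hcont).fun_neg
    have := hsq.fun_div₀ h'.tendsto_deriv (hcont.mul hcont).neg hcont' fun z hz => (hne z hz).2
    simpa only [pow_two] using this
  -- Write `k² / k'` as `k (z - z₀)` divided by `(z - z₀) k' / k`; the divisor has a nonzero limit.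
  have hlimit : Tendsto (fun z => -(k z) ^ 2 / deriv k z) (𝓝[≠] z₀) (𝓝 0) := by
    obtain ⟨a, ha, h1⟩ := h.exists_tendsto_quotient
    have hk0 : Tendsto k (𝓝[≠] z₀) (𝓝 0) := by
      have := h.analyticAt.continuousAt.tendsto.mono_left (nhdsWithin_le_nhds (s := {z₀}ᶜ))
      rwa [h.apply_eq_zero] at this
    have hz0 : Tendsto (fun z => z - z₀) (𝓝[≠] z₀) (𝓝 0) := by
      have : ContinuousAt (fun z : ℂ => z - z₀) z₀ := by fun_prop
      have := this.tendsto.mono_left (nhdsWithin_le_nhds (s := {z₀}ᶜ))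
      rwa [sub_self] at this
    have h2 := (hk0.mul hz0).neg.mul (h1.inv₀ ha)
    rw [mul_zero, neg_zero, zero_mul] at h2
    refine h2.congr' ?_
    filter_upwards [self_mem_nhdsWithin] with z hz
    have hz' : z - z₀ ≠ 0 := sub_ne_zero.mpr hz
    by_cases hk : k z = 0
    · simp [hk]
    by_cases hk' : deriv k z = 0
    · simp [hk']
    field_simp
  refine ⟨ρ / 2, half_pos h'.pos, _, (tendstoUniformlyOn_of_punctured h'.pos ?_ hlim hlimit).mono
    ball_subset_closedBall⟩
  exact hd.mono fun n hn => hn.mono (ball_subset_ball hρr)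

end ZeroLimit

/-! ### Polynomial growth, and transcendence of the derivative -/

lemma exists_polynomial_growth (p : Polynomial ℂ) :
    ∃ C ≥ 0, ∃ d : ℕ, ∀ z : ℂ, ‖p.eval z‖ ≤ C * (1 + ‖z‖) ^ d := by
  induction p using Polynomial.induction_on' with
  | add p q hp hq =>
    obtain ⟨C₁, hC₁, d₁, h₁⟩ := hp
    obtain ⟨C₂, hC₂, d₂, h₂⟩ := hq
    refine ⟨C₁ + C₂, by positivity, max d₁ d₂, fun z => ?_⟩
    have hz : 1 ≤ 1 + ‖z‖ := by linarith [norm_nonneg z]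
    rw [Polynomial.eval_add, add_mul]
    refine (norm_add_le _ _).trans (add_le_add ((h₁ z).trans ?_) ((h₂ z).trans ?_))
    · gcongr
      exact le_max_left _ _
    · gcongr
      exact le_max_right _ _
  | monomial n a =>
    refine ⟨‖a‖, norm_nonneg a, n, fun z => ?_⟩
    rw [Polynomial.eval_monomial, norm_mul, norm_pow]
    gcongr
    linarith

/-- An entire function of polynomial growth is a polynomial. -/
lemma exists_polynomial_of_growth (N : ℕ) : ∀ (g : ℂ → ℂ), Differentiable ℂ g →
    ∀ C : ℝ, (∀ z, ‖g z‖ ≤ C * (1 + ‖z‖) ^ N) → ∃ p : Polynomial ℂ, ∀ z, g z = p.eval z := by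
  induction N with
  | zero =>
    intro g hg C hC
    obtain ⟨c, hc⟩ := hg.exists_const_forall_eq_of_bounded
      (isBounded_iff_forall_norm_le.mpr ⟨C, by rintro _ ⟨z, rfl⟩; simpa using hC z⟩)
    exact ⟨Polynomial.C c, fun z => by rw [hc, Polynomial.eval_C]⟩
  | succ N ih =>
    intro g hg C hC
    have hd : Differentiable ℂ (dslope g 0) := by
      rw [← differentiableOn_univ, Complex.differentiableOn_dslope univ_mem]
      exact hg.differentiableOn
    obtain ⟨M, hM⟩ := (isCompact_closedBall (0 : ℂ) 1).exists_bound_of_continuousOn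
      hd.continuous.continuousOn
    have hC0 : ‖g 0‖ ≤ C := by simpa using hC 0
    have hCn : 0 ≤ C := (norm_nonneg _).trans hC0
    have hMn : 0 ≤ M := (norm_nonneg _).trans (hM 0 (by simp))
    -- `M` serves the unit disc. Outside it, `‖g z‖` and `‖g 0‖` are each at most `2 C (1 + ‖z‖) ^ N
    -- ‖z‖`, and division by `‖z‖` leaves `4 * C`.
    obtain ⟨p, hp⟩ := ih (dslope g 0) hd (M + 4 * C) (fun z => by
      have hz : 1 ≤ 1 + ‖z‖ := by linarith [norm_nonneg z]
      have hz1 : 1 ≤ (1 + ‖z‖) ^ N := one_le_pow₀ hz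
      by_cases hz2 : ‖z‖ ≤ 1
      · have := hM z (by simpa using hz2)
        nlinarith
      · push Not at hz2
        have hz0 : z ≠ 0 := by
          rintro rfl
          simp at hz2
          linarith
        rw [dslope_of_ne _ hz0, slope_def_field, sub_zero, norm_div, div_le_iff₀ (by linarith)]
        have h1 : ‖g z - g 0‖ ≤ C * (1 + ‖z‖) ^ (N + 1) + C :=
          (norm_sub_le _ _).trans (add_le_add (hC z) hC0)
        have h2 : C * (1 + ‖z‖) ^ (N + 1) ≤ C * ((1 + ‖z‖) ^ N * (2 * ‖z‖)) := by
          rw [pow_succ]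
          gcongr
          linarith
        have h3 : C ≤ C * ((1 + ‖z‖) ^ N * (2 * ‖z‖)) := by
          refine le_mul_of_one_le_right hCn ?_
          nlinarith
        have h4 : 0 ≤ M * (1 + ‖z‖) ^ N * ‖z‖ := by positivity
        nlinarith)
    refine ⟨Polynomial.C (g 0) + Polynomial.X * p, fun z => ?_⟩
    have := sub_smul_dslope g 0 z
    rw [sub_zero, smul_eq_mul, hp] at this
    rw [Polynomial.eval_add, Polynomial.eval_mul, Polynomial.eval_C, Polynomial.eval_X, this]
    ring

lemma exists_polynomial_lower_bound {q : Polynomial ℂ} (hq : q ≠ 0) :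
    ∃ R > 0, ∃ ε > 0, ∀ z : ℂ, R ≤ ‖z‖ → ε ≤ ‖q.eval z‖ := by
  by_cases hdeg : 0 < q.degree
  · have h := (q.tendsto_norm_atTop hdeg (z := id) (l := Bornology.cobounded ℂ)
      tendsto_norm_cobounded_atTop).eventually_ge_atTop 1
    obtain ⟨R, -, hR⟩ := (hasBasis_cobounded_norm (E := ℂ)).eventually_iff.mp h
    exact ⟨max R 1, by positivity, 1, one_pos, fun z hz => hR (le_of_max_le_left hz)⟩
  · have hc := Polynomial.eq_C_of_degree_le_zero (not_lt.mp hdeg)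
    have h0 : q.coeff 0 ≠ 0 := fun h => hq (by rw [hc, h, Polynomial.C_0])
    refine ⟨1, one_pos, ‖q.coeff 0‖, norm_pos_iff.mpr h0, fun z _ => ?_⟩
    rw [hc, Polynomial.eval_C]
    simp

/-- Polynomial growth of the derivative near infinity gives polynomial growth of the function. -/
lemma exists_growth_of_deriv {f : ℂ → ℂ} {R C : ℝ} {d : ℕ} (hR : 0 < R) (hC : 0 ≤ C)
    (hf : ∀ z, R ≤ ‖z‖ → DifferentiableAt ℂ f z)
    (hb : ∀ z, R ≤ ‖z‖ → ‖deriv f z‖ ≤ C * (1 + ‖z‖) ^ d) :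
    ∃ M ≥ 0, ∀ z, R ≤ ‖z‖ → ‖f z‖ ≤ M * (1 + ‖z‖) ^ (d + 1) := by
  obtain ⟨M, hM⟩ := (isCompact_sphere (0 : ℂ) R).exists_bound_of_continuousOn (f := f)
    fun z hz => (hf z (mem_sphere_zero_iff_norm.mp hz).ge).continuousAt.continuousWithinAt
  have hMn : 0 ≤ M := by
    obtain ⟨z, hz⟩ := (NormedSpace.sphere_nonempty (x := (0 : ℂ))).mpr hR.le
    exact (norm_nonneg _).trans (hM z hz)
  refine ⟨M + C, by positivity, fun z hz => ?_⟩
  have hz0 : 0 < ‖z‖ := hR.trans_le hz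
  -- The derivative is integrated along the ray from the projection of `z` to the circle of radius
  -- `R`; this segment stays where `f` is differentiable.
  have hw : ‖((R / ‖z‖ : ℝ) : ℂ) * z‖ = R := by
    rw [norm_mul, Complex.norm_real, Real.norm_of_nonneg (by positivity)]
    field_simp
  have hseg : ∀ x ∈ segment ℝ (((R / ‖z‖ : ℝ) : ℂ) * z) z, R ≤ ‖x‖ ∧ ‖x‖ ≤ ‖z‖ := by
    rintro x ⟨a, b, ha, hb, hab, rfl⟩
    have h1 : a • (((R / ‖z‖ : ℝ) : ℂ) * z) + b • z = ((a * (R / ‖z‖) + b : ℝ) : ℂ) * z := by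
      rw [Complex.real_smul, Complex.real_smul]
      push_cast
      ring
    have h2 : (a * (R / ‖z‖) + b) * ‖z‖ = a * R + b * ‖z‖ := by field_simp
    rw [h1, norm_mul, Complex.norm_real, Real.norm_of_nonneg (by positivity), h2]
    constructor <;> nlinarith
  have h1 := Convex.norm_image_sub_le_of_norm_deriv_le (𝕜 := ℂ) (f := f) (C := C * (1 + ‖z‖) ^ d)
    (fun x hx => hf x (hseg x hx).1) (fun x hx => (hb x (hseg x hx).1).trans (by
      have := (hseg x hx).2
      gcongr))
    (convex_segment _ _) (left_mem_segment ℝ (((R / ‖z‖ : ℝ) : ℂ) * z) z) (right_mem_segment ℝ _ z)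
  have h2 : ‖z - ((R / ‖z‖ : ℝ) : ℂ) * z‖ ≤ 1 + ‖z‖ := by
    have h3 : z - ((R / ‖z‖ : ℝ) : ℂ) * z = ((1 - R / ‖z‖ : ℝ) : ℂ) * z := by push_cast; ring
    have h4 : R / ‖z‖ ≤ 1 := (div_le_one hz0).mpr hz
    have h5 : 0 ≤ R / ‖z‖ := by positivity
    rw [h3, norm_mul, Complex.norm_real, Real.norm_of_nonneg (by linarith)]
    nlinarith
  have h3 := hM _ (mem_sphere_zero_iff_norm.mpr hw)
  have h4 : ‖f z‖ ≤ ‖f z - f (((R / ‖z‖ : ℝ) : ℂ) * z)‖ + ‖f (((R / ‖z‖ : ℝ) : ℂ) * z)‖ := by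
    have := norm_add_le (f z - f (((R / ‖z‖ : ℝ) : ℂ) * z)) (f (((R / ‖z‖ : ℝ) : ℂ) * z))
    rwa [sub_add_cancel] at this
  have h5 : 1 ≤ (1 + ‖z‖) ^ (d + 1) := one_le_pow₀ (by linarith)
  have h6 : C * (1 + ‖z‖) ^ d * ‖z - ((R / ‖z‖ : ℝ) : ℂ) * z‖ ≤ C * (1 + ‖z‖) ^ (d + 1) := by
    rw [pow_succ, ← mul_assoc]
    gcongr
  nlinarith

/-- If `f' = p / q`, the poles of `f` lie among the zeros of `q`, so `Q f` is entire for a suitable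
polynomial `Q ≠ 0`. Integration of `f'` bounds `f` polynomially near infinity; then `Q f` is a
polynomial and `f` is rational. -/
lemma IsTranscendentalMeromorphic.deriv {f : ℂ → ℂ} (hf : IsTranscendentalMeromorphic f) :
    IsTranscendentalMeromorphic (deriv f) := by
  refine ⟨fun z _ => meromorphicNFAt_deriv (hf.1 (mem_univ z)), ?_⟩
  rintro ⟨p, q, hq, hpq⟩
  refine hf.2 ?_
  have hnf : ∀ z, MeromorphicNFAt f z := fun z => hf.1 (mem_univ z)
  have han : ∀ z, q.eval z ≠ 0 → AnalyticAt ℂ f z := by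
    intro z hz
    refine analyticAt_of_not_pole (hnf z) fun hp => ?_
    have h1 : AnalyticAt ℂ (fun w => p.eval w / q.eval w) z :=
      (AnalyticAt.aeval_polynomial analyticAt_id p).div
        (AnalyticAt.aeval_polynomial analyticAt_id q) hz
    have h2 : _root_.deriv f =ᶠ[𝓝 z] fun w => p.eval w / q.eval w := by
      filter_upwards [q.continuous.continuousAt.eventually_ne hz] with w hw using hpq w hw
    exact not_pole_of_analyticAt (h1.congr h2.symm) (meromorphicOrderAt_deriv_lt_zero hp)
  -- By definition of `MeromorphicAt`, `n b` is an exponent for which `(z - b) ^ n b • f z` is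
  -- analytic at `b`.
  choose n hn using fun b => (hnf b).meromorphicAt
  classical
  let Q : Polynomial ℂ := ∏ b ∈ q.roots.toFinset, (Polynomial.X - Polynomial.C b) ^ n b
  have hQ : Q ≠ 0 :=
    Finset.prod_ne_zero_iff.mpr fun b _ => pow_ne_zero _ (Polynomial.X_sub_C_ne_zero b)
  have hg : ∀ z, AnalyticAt ℂ (fun w => Q.eval w * f w) z := by
    intro z
    by_cases hz : q.eval z = 0
    · have hmem : z ∈ q.roots.toFinset := by
        rw [Multiset.mem_toFinset, Polynomial.mem_roots hq]
        exact hz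
      have h1 : (fun w => Q.eval w * f w) = fun w =>
          (∏ b ∈ q.roots.toFinset.erase z, (Polynomial.X - Polynomial.C b) ^ n b).eval w *
            ((w - z) ^ n z • f w) := by
        funext w
        simp only [Q]
        rw [← Finset.mul_prod_erase _ _ hmem, Polynomial.eval_mul, Polynomial.eval_pow,
          Polynomial.eval_sub, Polynomial.eval_X, Polynomial.eval_C, smul_eq_mul]
        ring
      rw [h1]
      exact (AnalyticAt.aeval_polynomial analyticAt_id _).mul (hn z)
    · exact (AnalyticAt.aeval_polynomial analyticAt_id _).mul (han z hz)
  have hgd : Differentiable ℂ fun w => Q.eval w * f w := fun z => (hg z).differentiableAt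
  obtain ⟨R, hR, ε, hε, hlow⟩ := exists_polynomial_lower_bound hq
  obtain ⟨C, hC, d, hgrow⟩ := exists_polynomial_growth p
  have hne : ∀ z, R ≤ ‖z‖ → q.eval z ≠ 0 := fun z hz => norm_pos_iff.mp (hε.trans_le (hlow z hz))
  obtain ⟨M, hM, hfM⟩ := exists_growth_of_deriv (f := f) (C := C / ε) (d := d) hR (by positivity)
    (fun z hz => (han z (hne z hz)).differentiableAt) (fun z hz => by
      rw [hpq z (hne z hz), norm_div, div_mul_eq_mul_div]
      exact div_le_div₀ (by positivity) (hgrow z) hε (hlow z hz))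
  obtain ⟨C', hC', d', hQgrow⟩ := exists_polynomial_growth Q
  obtain ⟨B, hB⟩ := (isCompact_closedBall (0 : ℂ) R).exists_bound_of_continuousOn
    hgd.continuous.continuousOn
  have hBn : 0 ≤ B := (norm_nonneg _).trans (hB 0 (by simp [hR.le]))
  obtain ⟨P, hP⟩ := exists_polynomial_of_growth (d' + (d + 1)) _ hgd (B + C' * M) (fun z => by
    have h1 : 1 ≤ (1 + ‖z‖) ^ (d' + (d + 1)) := one_le_pow₀ (by linarith [norm_nonneg z])
    have h0 : 0 ≤ C' * M := by positivity
    by_cases hz : ‖z‖ ≤ R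
    · have := hB z (by simpa using hz)
      nlinarith
    · push Not at hz
      have h2 : ‖Q.eval z * f z‖ ≤ (C' * (1 + ‖z‖) ^ d') * (M * (1 + ‖z‖) ^ (d + 1)) := by
        rw [norm_mul]
        exact mul_le_mul (hQgrow z) (hfM z hz.le) (norm_nonneg _) (by positivity)
      have h3 : (C' * (1 + ‖z‖) ^ d') * (M * (1 + ‖z‖) ^ (d + 1)) =
          C' * M * (1 + ‖z‖) ^ (d' + (d + 1)) := by rw [pow_add]; ring
      nlinarith)
  exact ⟨P, Q, hQ, fun z hz => by rw [← hP z, mul_div_cancel_left₀ _ hz]⟩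

/-! ### Local coordinates and rescaling -/

/-- The point of the plane with local coordinate `z` at `h`. -/
noncomputable def localPoint (β : ℝ) (h z : ℂ) : ℂ := h + h ^ (-(β : ℂ)) * z

/-- The local coordinate at `h` of a point of the plane. -/
noncomputable def localCoord (β : ℝ) (h b : ℂ) : ℂ := (b - h) / h ^ (-(β : ℂ))

lemma norm_cpow_neg_real (h : ℂ) (β : ℝ) : ‖h ^ (-(β : ℂ))‖ = ‖h‖ ^ (-β) := by
  rw [← Complex.ofReal_neg, Complex.norm_cpow_real]

lemma cpow_neg_ne_zero {h : ℂ} (hh : h ≠ 0) (β : ℝ) : h ^ (-(β : ℂ)) ≠ 0 :=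
  fun H => hh (Complex.cpow_eq_zero_iff _ _ |>.mp H).1

@[simp] lemma localPoint_zero (β : ℝ) (h : ℂ) : localPoint β h 0 = h := by simp [localPoint]

lemma localPoint_localCoord (β : ℝ) {h : ℂ} (hh : h ≠ 0) (b : ℂ) :
    localPoint β h (localCoord β h b) = b := by
  rw [localPoint, localCoord, mul_div_cancel₀ _ (cpow_neg_ne_zero hh β)]
  ring

lemma norm_localCoord (β : ℝ) (h b : ℂ) : ‖localCoord β h b‖ = ‖h‖ ^ β * ‖h - b‖ := by
  rw [localCoord, norm_div, norm_cpow_neg_real, Real.rpow_neg (norm_nonneg h), div_inv_eq_mul,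
    norm_sub_rev, mul_comm]

lemma norm_localPoint_sub (β : ℝ) (h a b : ℂ) :
    ‖localPoint β h a - localPoint β h b‖ = ‖h‖ ^ (-β) * ‖a - b‖ := by
  have : localPoint β h a - localPoint β h b = h ^ (-(β : ℂ)) * (a - b) := by
    simp only [localPoint]; ring
  rw [this, norm_mul, norm_cpow_neg_real]

section Rescale

variable {α β : ℝ} {f : ℂ → ℂ} {h : ℂ}

lemma rescale_apply (z : ℂ) :
    rescale α β f h z = h ^ (-(α : ℂ)) * f (localPoint β h z) := rfl

lemma analyticAt_localPoint (z : ℂ) : AnalyticAt ℂ (localPoint β h) z := by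
  change AnalyticAt ℂ (fun z => h + h ^ (-(β : ℂ)) * z) z
  fun_prop

lemma deriv_localPoint (z : ℂ) : deriv (localPoint β h) z = h ^ (-(β : ℂ)) := by
  change deriv (fun z => h + h ^ (-(β : ℂ)) * z) z = _
  rw [deriv_const_add, deriv_const_mul_field, deriv_id'', mul_one]

lemma meromorphicOrderAt_rescale (hh : h ≠ 0) (z : ℂ) :
    meromorphicOrderAt (rescale α β f h) z = meromorphicOrderAt f (localPoint β h z) := by
  have h1 : rescale α β f h = (fun _ => h ^ (-(α : ℂ))) * (f ∘ localPoint β h) := rfl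
  rw [h1, meromorphicOrderAt_mul_of_ne_zero analyticAt_const (cpow_neg_ne_zero hh α),
    meromorphicOrderAt_comp_of_deriv_ne_zero (analyticAt_localPoint z)
      (by rw [deriv_localPoint]; exact cpow_neg_ne_zero hh β)]

lemma NontrivialMeromorphic.rescale (hf : NontrivialMeromorphic f) (hh : h ≠ 0) :
    NontrivialMeromorphic (rescale α β f h) where
  nf z _ := by
    have h1 : GeneralizedYosida.rescale α β f h =
      (fun _ => h ^ (-(α : ℂ))) * (f ∘ localPoint β h) := rfl
    rw [h1, meromorphicNFAt_mul_iff_right analyticAt_const (cpow_neg_ne_zero hh α)]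
    exact (hf.nfAt _).comp_analyticAt (analyticAt_localPoint z)
  order_ne_top z := by
    rw [meromorphicOrderAt_rescale hh]
    exact hf.order_ne_top _

lemma sphereValue_rescale (hh : h ≠ 0) (z : ℂ) [Decidable (meromorphicOrderAt f (localPoint β h z) < 0)] :
    sphereValue (rescale α β f h) z = if meromorphicOrderAt f (localPoint β h z) < 0 then
      OnePoint.infty else ((h ^ (-(α : ℂ)) * f (localPoint β h z) : ℂ) : OnePoint ℂ) := by
  rw [sphereValue, meromorphicOrderAt_rescale hh, rescale_apply]
  congr

/-- The inner derivative `h ^ (-β)` joins the outer factor `h ^ (-α)`; this is the origin of the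
class with exponent `α + β`. -/
lemma deriv_rescale (hh : h ≠ 0) :
    deriv (rescale α β f h) = rescale (α + β) β (deriv f) h := by
  funext z
  have h1 : rescale α β f h = fun z => h ^ (-(α : ℂ)) *
    (fun w => f (h + w)) (h ^ (-(β : ℂ)) * z) := rfl
  rw [h1, deriv_const_mul_field, deriv_comp_mul_left (h ^ (-(β : ℂ))) (fun w => f (h + w)),
    deriv_comp_const_add, rescale_apply, localPoint, smul_eq_mul, ← mul_assoc,
    ← Complex.cpow_add _ _ hh]
  congr 2
  push_cast
  ring

end Rescale

/-- Points with bounded local coordinate at a distant `h` have comparable modulus. -/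
lemma localPoint_comparable {β : ℝ} (hβ : -1 < β) (γ R : ℝ) : ∃ N > 0, ∀ h : ℂ, N ≤ ‖h‖ →
    ∀ a : ℂ, ‖a‖ ≤ R → ‖h‖ / 2 ≤ ‖localPoint β h a‖ ∧ ‖localPoint β h a‖ ^ γ ≤ 2 * ‖h‖ ^ γ := by
  have hc : ContinuousAt (fun t : ℝ => t ^ γ) 1 := Real.continuousAt_rpow_const 1 γ (Or.inl one_ne_zero)
  have h1 : ∀ᶠ t : ℝ in 𝓝 1, t ^ γ < 2 := hc.eventually_lt continuousAt_const (by norm_num)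
  obtain ⟨η, hη, hη'⟩ := Metric.eventually_nhds_iff.mp h1
  -- This quantity bounds the displacement relative to `‖h‖`; its decay is exactly the condition `β
  -- > -1`.
  have h2 : Tendsto (fun t : ℝ => t ^ (-(β + 1)) * R) atTop (𝓝 0) := by
    simpa using (tendsto_rpow_neg_atTop (by linarith : 0 < β + 1)).mul_const R
  obtain ⟨N, hN⟩ := eventually_atTop.mp
    (h2.eventually_lt_const (lt_min hη (by norm_num : (0 : ℝ) < 1 / 2)))
  refine ⟨max N 1, by positivity, fun h hh a ha => ?_⟩
  have hpos : 0 < ‖h‖ := one_pos.trans_le (le_of_max_le_right hh)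
  have h3 := hN ‖h‖ (le_of_max_le_left hh)
  have h4 : |‖localPoint β h a‖ - ‖h‖| ≤ ‖h‖ ^ (-β) * R := by
    refine (abs_norm_sub_norm_le _ _).trans ?_
    have := norm_localPoint_sub β h a 0
    rw [localPoint_zero, sub_zero] at this
    rw [this]
    gcongr
  have h5 : ‖h‖ ^ (-β) * R = ‖h‖ * (‖h‖ ^ (-(β + 1)) * R) := by
    have : ‖h‖ ^ (-β) = ‖h‖ * ‖h‖ ^ (-(β + 1)) := by
      calc ‖h‖ ^ (-β) = ‖h‖ ^ (1 + -(β + 1)) := by congr 1; ring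
        _ = ‖h‖ * ‖h‖ ^ (-(β + 1)) := by rw [Real.rpow_add hpos, Real.rpow_one]
    rw [this, mul_assoc]
  rw [h5] at h4
  have h6 := h3.trans_le (min_le_left _ _)
  have h7 := h3.trans_le (min_le_right _ _)
  constructor
  · have := neg_le_of_abs_le h4
    nlinarith
  · have h8 : ‖localPoint β h a‖ = ‖h‖ * (‖localPoint β h a‖ / ‖h‖) := by field_simp
    have h9 : |‖localPoint β h a‖ / ‖h‖ - 1| < η := by
      rw [div_sub_one hpos.ne', abs_div, abs_of_pos hpos, div_lt_iff₀ hpos]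
      nlinarith
    have h10 := hη' (y := ‖localPoint β h a‖ / ‖h‖) h9
    rw [h8, Real.mul_rpow hpos.le (by positivity), mul_comm]
    gcongr

/-! ### Separation conditions -/

lemma separated_iff {β : ℝ} {A : Set ℂ} {B : ℂ → Set ℂ} (hA : ∀ c ∈ A, c ≠ 0) :
    (0 < ⨅ c ∈ A, ENNReal.ofReal (‖c‖ ^ β) * Metric.infEDist c (B c)) ↔
      ∃ δ > 0, ∀ c ∈ A, ∀ b ∈ B c, δ ≤ ‖c‖ ^ β * ‖c - b‖ := by
  constructor
  · intro h
    obtain ⟨r, hr0, hr⟩ := ENNReal.lt_iff_exists_nnreal_btwn.mp h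
    refine ⟨r, by exact_mod_cast hr0, fun c hc b hb => ?_⟩
    have h1 : (r : ENNReal) ≤ ENNReal.ofReal (‖c‖ ^ β) * ENNReal.ofReal ‖c - b‖ := by
      refine (hr.le.trans (iInf₂_le c hc)).trans ?_
      gcongr
      rw [← dist_eq_norm, ← edist_dist]
      exact Metric.infEDist_le_edist_of_mem hb
    rw [← ENNReal.ofReal_mul (by positivity), ← ENNReal.ofReal_coe_nnreal] at h1
    exact (ENNReal.ofReal_le_ofReal_iff (by positivity)).mp h1
  · rintro ⟨δ, hδ, h⟩
    refine (ENNReal.ofReal_pos.mpr hδ).trans_le (le_iInf₂ fun c hc => ?_)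
    have hpos : 0 < ‖c‖ ^ β := Real.rpow_pos_of_pos (norm_pos_iff.mpr (hA c hc)) β
    have h1 : ENNReal.ofReal (δ / ‖c‖ ^ β) ≤ Metric.infEDist c (B c) := by
      refine Metric.le_infEDist.mpr fun b hb => ?_
      rw [edist_dist, dist_eq_norm]
      refine ENNReal.ofReal_le_ofReal ?_
      rw [div_le_iff₀ hpos, mul_comm]
      exact h c hc b hb
    calc ENNReal.ofReal δ = ENNReal.ofReal (‖c‖ ^ β) * ENNReal.ofReal (δ / ‖c‖ ^ β) := by
          rw [← ENNReal.ofReal_mul hpos.le]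
          congr 1
          field_simp
      _ ≤ _ := by gcongr

/-- Offending pairs must escape to infinity because the zeros of `D` are isolated: along a bounded
subsequence `c n` would eventually equal some `x ≠ 0`, and then zeros `b n ≠ x` of `D` would cluster
at `x`. In the applications `D = deriv f`, which vanishes at critical points and, by default, at
poles. -/
lemma exists_sequences_of_not_separated {β : ℝ} {D : ℂ → ℂ} {A : Set ℂ} {B : ℂ → Set ℂ}
    (hD : ∀ x, ∀ᶠ z in 𝓝[≠] x, D z ≠ 0) (hA : ∀ c ∈ A, c ≠ 0 ∧ D c = 0)
    (hB : ∀ c ∈ A, ∀ b ∈ B c, D b = 0 ∧ b ≠ c)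
    (h : ¬ ∃ δ > 0, ∀ c ∈ A, ∀ b ∈ B c, δ ≤ ‖c‖ ^ β * ‖c - b‖) :
    ∃ c b : ℕ → ℂ, (∀ n, c n ∈ A ∧ b n ∈ B (c n) ∧ 1 ≤ ‖c n‖) ∧
      Tendsto (fun n => ‖c n‖) atTop atTop ∧ Tendsto (fun n => ‖c n‖ ^ β * ‖c n - b n‖) atTop (𝓝 0) := by
  push Not at h
  have h' : ∀ n : ℕ, ∃ c b : ℂ, c ∈ A ∧ b ∈ B c ∧ ‖c‖ ^ β * ‖c - b‖ < 1 / ((n : ℝ) + 1) := by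
    intro n
    obtain ⟨c, hc, b, hb, hcb⟩ := h (1 / ((n : ℝ) + 1)) (by positivity)
    exact ⟨c, b, hc, hb, hcb⟩
  choose c b hc hb hcb using h'
  have hlim : Tendsto (fun n => ‖c n‖ ^ β * ‖c n - b n‖) atTop (𝓝 0) :=
    squeeze_zero (fun n => by positivity) (fun n => (hcb n).le)
      tendsto_one_div_add_atTop_nhds_zero_nat
  have hinf : Tendsto (fun n => ‖c n‖) atTop atTop := by
    by_contra hnot
    rw [Filter.tendsto_atTop] at hnot
    push Not at hnot
    obtain ⟨R, hR⟩ := hnot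
    have hfreq : ∃ᶠ n in atTop, c n ∈ closedBall (0 : ℂ) R :=
      hR.mono fun n hn => by simpa using hn.le
    obtain ⟨x, -, φ, hφ, hx⟩ := tendsto_subseq_of_frequently_bounded isBounded_closedBall hfreq
    have hiso := hD x
    rw [eventually_nhdsWithin_iff] at hiso
    have h1 : ∀ᶠ n in atTop, c (φ n) = x := by
      filter_upwards [hx.eventually hiso] with n hn
      by_contra hne
      exact hn hne (hA _ (hc _)).2
    obtain ⟨n₀, hn₀⟩ := h1.exists
    have hx0 : 0 < ‖x‖ := norm_pos_iff.mpr (hn₀ ▸ (hA _ (hc (φ n₀))).1)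
    have h2 : Tendsto (fun n => b (φ n)) atTop (𝓝 x) := by
      rw [tendsto_iff_norm_sub_tendsto_zero]
      have h3 := (hlim.comp hφ.tendsto_atTop).const_mul ((‖x‖ ^ β)⁻¹)
      rw [mul_zero] at h3
      refine h3.congr' ?_
      filter_upwards [h1] with n hn
      have : 0 < ‖x‖ ^ β := Real.rpow_pos_of_pos hx0 β
      rw [Function.comp_apply, hn, norm_sub_rev, inv_mul_cancel_left₀ this.ne']
    obtain ⟨n, hn1, hn2⟩ := (h1.and (h2.eventually hiso)).exists
    have hb' := hB _ (hc (φ n)) _ (hb (φ n))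
    exact hn2 (fun h => hb'.2 (by rw [hn1]; exact h)) hb'.1
  obtain ⟨N, hN⟩ := eventually_atTop.mp (hinf.eventually_ge_atTop 1)
  refine ⟨fun n => c (n + N), fun n => b (n + N),
    fun n => ⟨hc _, hb _, hN _ (Nat.le_add_left _ _)⟩, ?_, ?_⟩
  · exact hinf.comp (tendsto_add_atTop_nat N)
  · exact hlim.comp (tendsto_add_atTop_nat N)

/-- In local coordinates at distant points, a separation condition becomes a uniform one. -/
lemma eventually_separated {β : ℝ} (hβ : -1 < β) {A : Set ℂ} {B : ℂ → Set ℂ} {δ : ℝ}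
    (h : ∀ c ∈ A, ∀ b ∈ B c, δ ≤ ‖c‖ ^ β * ‖c - b‖) (R : ℝ) {u : ℕ → ℂ}
    (hu : Tendsto (fun n => ‖u n‖) atTop atTop) :
    ∀ᶠ n in atTop, ∀ a a' : ℂ, ‖a‖ ≤ R → localPoint β (u n) a ∈ A →
      localPoint β (u n) a' ∈ B (localPoint β (u n) a) → δ / 2 ≤ ‖a - a'‖ := by
  obtain ⟨N, hN, hcomp⟩ := localPoint_comparable hβ β R
  filter_upwards [hu.eventually_ge_atTop N] with n hn a a' ha hA hB
  have hpos : 0 < ‖u n‖ := hN.trans_le hn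
  have h1 := h _ hA _ hB
  rw [norm_localPoint_sub] at h1
  have h2 := (hcomp _ hn a ha).2
  have h3 : ‖localPoint β (u n) a‖ ^ β * (‖u n‖ ^ (-β) * ‖a - a'‖) ≤
      2 * ‖u n‖ ^ β * (‖u n‖ ^ (-β) * ‖a - a'‖) := by gcongr
  have h4 : 2 * ‖u n‖ ^ β * (‖u n‖ ^ (-β) * ‖a - a'‖) = 2 * ‖a - a'‖ := by
    have : ‖u n‖ ^ β * ‖u n‖ ^ (-β) = 1 := by rw [← Real.rpow_add hpos]; simp
    linear_combination 2 * ‖a - a'‖ * this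
  linarith

lemma eventually_localPoint_ne_zero {β : ℝ} (hβ : -1 < β) (R : ℝ) {u : ℕ → ℂ}
    (hu : Tendsto (fun n => ‖u n‖) atTop atTop) :
    ∀ᶠ n in atTop, ∀ a : ℂ, ‖a‖ ≤ R → localPoint β (u n) a ≠ 0 := by
  obtain ⟨N, hN, hcomp⟩ := localPoint_comparable hβ 1 R
  filter_upwards [hu.eventually_ge_atTop N] with n hn a ha
  have := (hcomp _ hn a ha).1
  exact norm_pos_iff.mp (by linarith)

/-! ### Normality along bounded sequences -/

/-- On a bounded set of base points normality is mere compactness. The limits `u` and `s` of the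
powers are extracted separately from the limit `x` of the base points, since the principal powers
can jump across the negative axis; their moduli are continuous, which gives `s ≠ 0`. -/
lemma exists_subseq_of_not_tendsto {α β : ℝ} {D : ℂ → ℂ} (hD : NontrivialMeromorphic D)
    {h : ℕ → ℂ} (h1 : ∀ n, 1 ≤ ‖h n‖) (hb : ¬ Tendsto (fun n => ‖h n‖) atTop atTop) :
    ∃ φ : ℕ → ℕ, StrictMono φ ∧ ∃ g : ℂ → OnePoint ℂ,
      TendstoSpherically (fun n => sphereValue (rescale α β D (h (φ n)))) g := by
  classical
  rw [Filter.tendsto_atTop] at hb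
  push Not at hb
  obtain ⟨R, hR⟩ := hb
  have hbound : ∀ (γ : ℝ) (w : ℂ), 1 ≤ ‖w‖ → ‖w‖ < R → ‖w ^ (-(γ : ℂ))‖ ≤ R ^ |γ| := by
    intro γ w hw hwR
    rw [norm_cpow_neg_real]
    calc ‖w‖ ^ (-γ) ≤ ‖w‖ ^ |γ| := Real.rpow_le_rpow_of_exponent_le hw (neg_le_abs γ)
      _ ≤ R ^ |γ| := Real.rpow_le_rpow (norm_nonneg _) hwR.le (abs_nonneg γ)
  have hfreq : ∃ᶠ n in atTop, (h n, h n ^ (-(β : ℂ)), h n ^ (-(α : ℂ))) ∈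
      closedBall (0 : ℂ) R ×ˢ closedBall (0 : ℂ) (R ^ |β|) ×ˢ closedBall (0 : ℂ) (R ^ |α|) := by
    refine hR.mono fun n hn => ⟨?_, ?_, ?_⟩
    · simpa using hn.le
    · simpa using hbound β _ (h1 n) hn
    · simpa using hbound α _ (h1 n) hn
  obtain ⟨⟨x, u, s⟩, -, φ, hφ, hlim⟩ := tendsto_subseq_of_frequently_bounded
    (isBounded_closedBall.prod (isBounded_closedBall.prod isBounded_closedBall)) hfreq
  have hx : Tendsto (fun n => h (φ n)) atTop (𝓝 x) := (continuous_fst.tendsto _).comp hlim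
  have hu : Tendsto (fun n => h (φ n) ^ (-(β : ℂ))) atTop (𝓝 u) :=
    (continuous_fst.tendsto _).comp ((continuous_snd.tendsto _).comp hlim)
  have hs : Tendsto (fun n => h (φ n) ^ (-(α : ℂ))) atTop (𝓝 s) :=
    (continuous_snd.tendsto _).comp ((continuous_snd.tendsto _).comp hlim)
  have hx1 : 1 ≤ ‖x‖ := ge_of_tendsto hx.norm (Eventually.of_forall fun n => h1 _)
  have hx0 : 0 < ‖x‖ := one_pos.trans_le hx1
  have hs0 : s ≠ 0 := by
    have h2 : Tendsto (fun n => ‖h (φ n)‖ ^ (-α)) atTop (𝓝 (‖x‖ ^ (-α))) :=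
      hx.norm.rpow_const (Or.inl hx0.ne')
    have h3 := hs.norm
    simp only [norm_cpow_neg_real] at h3
    have h4 := tendsto_nhds_unique h3 h2
    exact norm_pos_iff.mp (h4 ▸ Real.rpow_pos_of_pos hx0 _)
  refine ⟨φ, hφ, fun z => if meromorphicOrderAt D (x + u * z) < 0 then OnePoint.infty
    else ((s * D (x + u * z) : ℂ) : OnePoint ℂ), ?_⟩
  rw [tendstoSpherically_iff, Metric.tendstoLocallyUniformly_iff]
  intro ε hε z₀
  have hc := hD.continuousAt_scaled hs0 (x + u * z₀)
  have hΨ : Tendsto (fun q : (ℂ × ℂ × ℂ) × ℂ => ((q.1.2.2, q.1.1 + q.1.2.1 * q.2) : ℂ × ℂ))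
      (𝓝 ((x, u, s), z₀)) (𝓝 (s, x + u * z₀)) := by
    have : Continuous fun q : (ℂ × ℂ × ℂ) × ℂ => ((q.1.2.2, q.1.1 + q.1.2.1 * q.2) : ℂ × ℂ) := by
      fun_prop
    exact this.tendsto ((x, u, s), z₀)
  have hev := Metric.tendsto_nhds.mp (hc.tendsto.comp hΨ) (ε / 2) (half_pos hε)
  rw [nhds_prod_eq] at hev
  obtain ⟨P, hP, Q, hQ, hPQ⟩ := eventually_prod_iff.mp hev
  refine ⟨{z | Q z}, hQ, ?_⟩
  filter_upwards [hlim.eventually hP] with n hn z hz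
  have e1 := hPQ hn hz
  have e2 := hPQ hP.self_of_nhds hz
  have hne : h (φ n) ≠ 0 := norm_pos_iff.mp (one_pos.trans_le (h1 _))
  rw [sphereValue_rescale hne]
  refine (dist_triangle_right _ _ _).trans_lt ((add_lt_add e2 e1).trans_eq (add_halves ε))

/-! ### Limit functions near their poles -/

lemma TendstoSpherically.eq_of_tendsto {F : ℕ → ℂ → ℂ} (hF : ∀ n, NontrivialMeromorphic (F n))
    {g : ℂ → OnePoint ℂ} (h : TendstoSpherically (fun n => sphereValue (F n)) g) {w : ℕ → ℂ} {z₀ : ℂ}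
    (hw : Tendsto w atTop (𝓝 z₀)) {x : OnePoint ℂ} (hx : ∀ n, sphereValue (F n) (w n) = x) :
    g z₀ = x := by
  have h1 := (tendstoSpherically_iff.mp h).tendsto_comp
    (continuous_of_tendstoSpherically hF h).continuousAt hw
  simp only [hx] at h1
  exact stereo_injective (tendsto_nhds_unique h1 tendsto_const_nhds)

/-- Near a point where a non-constant spherical limit is infinite, the reciprocals converge to a
non-trivial holomorphic function. -/
lemma exists_zeroLimit {F : ℕ → ℂ → ℂ} (hF : ∀ n, NontrivialMeromorphic (F n))
    {g : ℂ → OnePoint ℂ} (h : TendstoSpherically (fun n => sphereValue (F n)) g)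
    (hg : ¬ ∃ w, ∀ z, g z = w) {z₀ : ℂ} (hz₀ : g z₀ = OnePoint.infty) :
    ∃ r > 0, ∃ H : ℂ → ℂ, ZeroLimit (fun n => (F n)⁻¹) H z₀ r ∧
      ∀ z ∈ ball z₀ r, g z = sphereInv (H z : OnePoint ℂ) := by
  obtain ⟨r, hr, H, h0, h1, h2, h3⟩ := exists_analytic_limit_inv hF h hz₀
  refine ⟨r, hr, H, ⟨hr, h2, h3, fun n z => (hF n).inv.order_ne_top z, h0, fun htop => ?_⟩, h1⟩
  have han := analyticOnNhd_limit h2 h3 z₀ (mem_ball_self hr)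
  rw [meromorphicOrderAt_eq_top_iff, eventually_nhdsWithin_iff] at htop
  refine hg ⟨OnePoint.infty, eq_infty_of_eventually hF h (z₀ := z₀) ?_⟩
  filter_upwards [htop, isOpen_ball.mem_nhds (mem_ball_self hr)] with z hz hzb
  have : H z = 0 := by
    by_cases hne : z = z₀
    · rw [hne, h0]
    · exact hz hne
  rw [h1 z hzb, this, sphereInv_zero]

namespace NontrivialMeromorphic

variable {F : ℂ → ℂ} {z : ℂ}

lemma not_pole_and_deriv_eq_zero (hF : NontrivialMeromorphic F) (hz : AnalyticAt ℂ F⁻¹ z)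
    (h0 : F⁻¹ z ≠ 0) (hd : deriv F⁻¹ z = 0) : ¬ meromorphicOrderAt F z < 0 ∧ deriv F z = 0 := by
  constructor
  · intro hp
    exact h0 (by rw [Pi.inv_apply, eq_zero_of_pole (hF.nfAt z) hp, inv_zero])
  · have := hF.inv_deriv_eq hz
    rw [hd, div_zero, Pi.inv_apply, inv_eq_zero] at this
    exact this

lemma pole_of_inv_eq_zero (hF : NontrivialMeromorphic F) (hz : AnalyticAt ℂ F⁻¹ z)
    (h0 : F⁻¹ z = 0) : meromorphicOrderAt F z < 0 := by
  by_contra hp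
  exact not_pole_of_analyticAt hz (hF.pole_inv_iff.mpr ⟨hp, by simpa using h0⟩)

lemma deriv_inv_eq_zero (hF : NontrivialMeromorphic F) (hz : AnalyticAt ℂ F⁻¹ z)
    (hp : ¬ meromorphicOrderAt F z < 0) (hd : deriv F z = 0) : deriv F⁻¹ z = 0 := by
  have h0 : F z ≠ 0 := fun h0 => not_pole_of_analyticAt hz (hF.pole_inv_iff.mpr ⟨hp, h0⟩)
  rw [deriv_inv'' (analyticAt_of_not_pole (hF.nfAt z) hp).differentiableAt h0, hd]
  simp

end NontrivialMeromorphic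

/-! ### The two separation conditions -/

section Yosida

variable {α β : ℝ} {f : ℂ → ℂ}

lemma IsYosida.exists_subseq (hf : IsYosida α β f) {h : ℕ → ℂ} (h1 : ∀ n, 1 ≤ ‖h n‖)
    (hinf : Tendsto (fun n => ‖h n‖) atTop atTop) :
    ∃ φ : ℕ → ℕ, StrictMono φ ∧ ∃ g : ℂ → OnePoint ℂ,
      TendstoSpherically (fun n => sphereValue (rescale α β f (h (φ n)))) g ∧
      ¬ ∃ w, ∀ z, g z = w := by
  obtain ⟨φ, hφ, g, hg⟩ := hf.normal fun n => ⟨h n, h1 n⟩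
  exact ⟨φ, hφ, g, hg, hf.nonconstant g ⟨fun n => h (φ n), hinf.comp hφ.tendsto_atTop, hg⟩⟩

lemma ne_zero_of_one_le_norm {h : ℂ} (hh : 1 ≤ ‖h‖) : h ≠ 0 := norm_pos_iff.mp (one_pos.trans_le hh)

lemma rescale_pole_of_pole {h : ℂ} (hh : h ≠ 0) {b : ℂ} (hb : meromorphicOrderAt f b < 0) :
    meromorphicOrderAt (rescale α β f h) (localCoord β h b) < 0 := by
  rwa [meromorphicOrderAt_rescale hh, localPoint_localCoord β hh]

lemma deriv_rescale_eq_zero_iff {h : ℂ} (hh : h ≠ 0) {z : ℂ} :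
    deriv (rescale α β f h) z = 0 ↔ deriv f (localPoint β h z) = 0 := by
  rw [deriv_rescale hh, rescale_apply, mul_eq_zero, or_iff_right (cpow_neg_ne_zero hh _)]

/-- The poles of `f` are uniformly separated from the critical points. -/
def CriticalSeparated (β : ℝ) (f : ℂ → ℂ) : Prop :=
  ∃ δ > 0, ∀ c ∈ criticalPoints f, ∀ b ∈ poles f, δ ≤ ‖c‖ ^ β * ‖c - b‖

/-- The poles of `f` are uniformly separated from each other. -/
def PolesSeparated (β : ℝ) (f : ℂ → ℂ) : Prop :=
  ∃ δ > 0, ∀ p ∈ poles f, ∀ q ∈ poles f \ {p}, δ ≤ ‖p‖ ^ β * ‖p - q‖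

lemma deriv_ne_zero_nhdsNE (hf : IsTranscendentalMeromorphic f) (x : ℂ) :
    ∀ᶠ z in 𝓝[≠] x, deriv f z ≠ 0 :=
  (hf.deriv.nontrivialMeromorphic.eventually_not_pole_and_ne_zero x).mono fun _ h => h.2

lemma exists_sequences_of_not_criticalSeparated (hf : IsTranscendentalMeromorphic f)
    (h : ¬ CriticalSeparated β f) : ∃ c b : ℕ → ℂ,
      (∀ n, c n ∈ criticalPoints f ∧ b n ∈ poles f ∧ 1 ≤ ‖c n‖) ∧
      Tendsto (fun n => ‖c n‖) atTop atTop ∧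
      Tendsto (fun n => localCoord β (c n) (b n)) atTop (𝓝 0) := by
  obtain ⟨c, b, h1, h2, h3⟩ := exists_sequences_of_not_separated (D := deriv f)
    (A := criticalPoints f) (B := fun _ => poles f) (deriv_ne_zero_nhdsNE hf)
    (fun c hc => ⟨hc.1, hc.2.2⟩)
    (fun c hc b hb => ⟨deriv_eq_zero_of_pole hb.2, fun h => hc.2.1 (h ▸ hb.2)⟩) h
  refine ⟨c, b, h1, h2, ?_⟩
  rw [tendsto_zero_iff_norm_tendsto_zero]
  simpa only [norm_localCoord] using h3

lemma exists_sequences_of_not_polesSeparated (hf : IsTranscendentalMeromorphic f)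
    (h : ¬ PolesSeparated β f) : ∃ p q : ℕ → ℂ,
      (∀ n, p n ∈ poles f ∧ q n ∈ poles f \ {p n} ∧ 1 ≤ ‖p n‖) ∧
      Tendsto (fun n => ‖p n‖) atTop atTop ∧
      Tendsto (fun n => localCoord β (p n) (q n)) atTop (𝓝 0) := by
  obtain ⟨c, b, h1, h2, h3⟩ := exists_sequences_of_not_separated (D := deriv f)
    (A := poles f) (B := fun p => poles f \ {p}) (deriv_ne_zero_nhdsNE hf)
    (fun c hc => ⟨hc.1, deriv_eq_zero_of_pole hc.2⟩)
    (fun c hc b hb => ⟨deriv_eq_zero_of_pole hb.1.2, hb.2⟩) h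
  refine ⟨c, b, h1, h2, ?_⟩
  rw [tendsto_zero_iff_norm_tendsto_zero]
  simpa only [norm_localCoord] using h3

/-- Near limits of poles of the rescaled functions there are no critical points. -/
lemma eventually_no_critical (hβ : -1 < β) {δ : ℝ}
    (hδ : ∀ c ∈ criticalPoints f, ∀ b ∈ poles f, δ ≤ ‖c‖ ^ β * ‖c - b‖) {h : ℕ → ℂ}
    (h1 : ∀ n, 1 ≤ ‖h n‖) (hinf : Tendsto (fun n => ‖h n‖) atTop atTop) (z₀ : ℂ) :
    ∀ᶠ n in atTop, ∀ p ∈ ball z₀ (δ / 4), meromorphicOrderAt (rescale α β f (h n)) p < 0 →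
      ∀ z ∈ ball z₀ (δ / 4), ¬ meromorphicOrderAt (rescale α β f (h n)) z < 0 →
        deriv (rescale α β f (h n)) z ≠ 0 := by
  have hnorm : ∀ z ∈ ball z₀ (δ / 4), ‖z‖ ≤ ‖z₀‖ + δ / 4 := by
    intro z hz
    rw [mem_ball, dist_eq_norm] at hz
    have := norm_add_le (z - z₀) z₀
    rw [sub_add_cancel] at this
    linarith
  filter_upwards [eventually_separated hβ hδ (‖z₀‖ + δ / 4) hinf,
    eventually_localPoint_ne_zero hβ (‖z₀‖ + δ / 4) hinf] with n h2 h3 p hp hpole z hz hzp hzd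
  have hn := ne_zero_of_one_le_norm (h1 n)
  rw [meromorphicOrderAt_rescale hn] at hpole hzp
  have h4 := h2 z p (hnorm z hz) ⟨h3 z (hnorm z hz), hzp, (deriv_rescale_eq_zero_iff hn).mp hzd⟩
    ⟨h3 p (hnorm p hp), hpole⟩
  -- Two points of the ball of radius `δ / 4` are less than `δ / 2` apart, and `δ / 2` is what
  -- remains of `δ` in local coordinates.
  have h5 := dist_triangle_right z p z₀
  rw [mem_ball] at hz hp
  rw [dist_eq_norm z p] at h5
  linarith

/-- Rescale `f'` at critical points `c n` whose nearby poles tend to `0` in the local coordinate: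
the continuous limit is `0` at the origin because of the former and `∞` because of the latter. -/
theorem criticalSeparated_of_isYosida_deriv (hf : IsTranscendentalMeromorphic f)
    (hf' : IsYosida (α + β) β (deriv f)) : CriticalSeparated β f := by
  by_contra hnot
  obtain ⟨c, b, h1, hinf, hw⟩ := exists_sequences_of_not_criticalSeparated hf hnot
  obtain ⟨φ, hφ, g, hg, -⟩ := hf'.exists_subseq (fun n => (h1 n).2.2) hinf
  have hne : ∀ n, c n ≠ 0 := fun n => ne_zero_of_one_le_norm (h1 n).2.2
  have hF : ∀ n, NontrivialMeromorphic (rescale (α + β) β (deriv f) (c (φ n))) :=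
    fun n => hf'.transcendental.nontrivialMeromorphic.rescale (hne _)
  have e1 := hg.eq_of_tendsto hF (w := fun _ => 0) (x := ((0 : ℂ) : OnePoint ℂ))
    tendsto_const_nhds fun n => by
      obtain ⟨hc, -, -⟩ := h1 (φ n)
      rw [sphereValue_of_not_pole, rescale_apply, localPoint_zero, hc.2.2, mul_zero]
      rw [meromorphicOrderAt_rescale (hne _), localPoint_zero,
        deriv_pole_iff (hf.nontrivialMeromorphic.nfAt _)]
      exact hc.2.1
  have e2 := hg.eq_of_tendsto hF (x := OnePoint.infty) (hw.comp hφ.tendsto_atTop) fun n =>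
    sphereValue_of_pole (rescale_pole_of_pole (hne _)
      (meromorphicOrderAt_deriv_lt_zero (h1 (φ n)).2.1.2))
  rw [e1] at e2
  exact OnePoint.coe_ne_infty _ e2

/-- Rescale at poles `p n` with other poles merging into them. The hypothesis leaves the reciprocals
no critical points near `0` except their zeros, so `ZeroLimit.eq_of_zeros` identifies the two poles.
-/
theorem polesSeparated_of_criticalSeparated (hβ : -1 < β) (hf : IsYosida α β f)
    (h : CriticalSeparated β f) : PolesSeparated β f := by
  obtain ⟨δ, hδ, hsep⟩ := h
  by_contra hnot
  obtain ⟨p, q, h1, hinf, hw⟩ := exists_sequences_of_not_polesSeparated hf.transcendental hnot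
  obtain ⟨φ, hφ, g, hg, hgc⟩ := hf.exists_subseq (fun n => (h1 n).2.2) hinf
  have hne : ∀ n, p n ≠ 0 := fun n => ne_zero_of_one_le_norm (h1 n).2.2
  have hF : ∀ n, NontrivialMeromorphic (rescale α β f (p (φ n))) :=
    fun n => hf.transcendental.nontrivialMeromorphic.rescale (hne _)
  have hpole0 : ∀ n, meromorphicOrderAt (rescale α β f (p (φ n))) 0 < 0 := fun n => by
    rw [meromorphicOrderAt_rescale (hne _), localPoint_zero]
    exact (h1 (φ n)).1.2
  have hg0 := hg.eq_of_tendsto hF (w := fun _ => 0) (x := OnePoint.infty)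
    tendsto_const_nhds fun n => sphereValue_of_pole (hpole0 n)
  obtain ⟨r, hr, H, hZ, -⟩ := exists_zeroLimit hF hg hgc hg0
  have hZ' := hZ.mono (lt_min hr (by positivity : 0 < δ / 4)) (min_le_left r (δ / 4))
  have hq := hw.comp hφ.tendsto_atTop
  have hcrit : ∀ᶠ n in atTop, ∀ z ∈ ball (0 : ℂ) (min r (δ / 4)),
      deriv (rescale α β f (p (φ n)))⁻¹ z = 0 → (rescale α β f (p (φ n)))⁻¹ z = 0 := by
    filter_upwards [hZ'.analytic, eventually_no_critical (α := α) hβ hsep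
      (fun n => (h1 (φ n)).2.2) (hinf.comp hφ.tendsto_atTop) 0] with n h2 h3 z hz hd
    by_contra h0
    obtain ⟨h4, h5⟩ := (hF n).not_pole_and_deriv_eq_zero (h2 z hz) h0 hd
    exact h3 0 (mem_ball_self (by positivity)) (hpole0 n) z
      (ball_subset_ball (min_le_right _ _) hz) h4 h5
  obtain ⟨n, hn⟩ := (hZ'.eq_of_zeros tendsto_const_nhds (p := fun _ => 0)
    (fun n => by rw [Pi.inv_apply, eq_zero_of_pole ((hF n).nfAt 0) (hpole0 n), inv_zero])
    hcrit hq).exists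
  have hpq : meromorphicOrderAt (rescale α β f (p (φ n))) (localCoord β (p (φ n)) (q (φ n))) < 0 :=
    rescale_pole_of_pole (hne _) (h1 (φ n)).2.1.1.2
  have h2 := hn (by
    rw [Function.comp_apply, Pi.inv_apply, eq_zero_of_pole ((hF n).nfAt _) hpq, inv_zero])
  have h3 := localPoint_localCoord β (hne (φ n)) (q (φ n))
  rw [Function.comp_apply] at h2
  rw [h2, localPoint_zero] at h3
  exact (h1 (φ n)).2.1.2 h3.symm

/-- Rescale at critical points `c n` with poles merging into them. The hypothesis leaves the
reciprocals at most one zero near `0`, so `ZeroLimit.eq_zero_of_deriv_eq_zero` puts the critical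
point at the pole itself, which is absurd. -/
theorem criticalSeparated_of_polesSeparated (hβ : -1 < β) (hf : IsYosida α β f)
    (h : PolesSeparated β f) : CriticalSeparated β f := by
  obtain ⟨δ, hδ, hsep⟩ := h
  by_contra hnot
  obtain ⟨c, b, h1, hinf, hw⟩ := exists_sequences_of_not_criticalSeparated hf.transcendental hnot
  obtain ⟨φ, hφ, g, hg, hgc⟩ := hf.exists_subseq (fun n => (h1 n).2.2) hinf
  have hne : ∀ n, c n ≠ 0 := fun n => ne_zero_of_one_le_norm (h1 n).2.2
  have hF : ∀ n, NontrivialMeromorphic (rescale α β f (c (φ n))) :=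
    fun n => hf.transcendental.nontrivialMeromorphic.rescale (hne _)
  have hq := hw.comp hφ.tendsto_atTop
  have hpole : ∀ n, meromorphicOrderAt (rescale α β f (c (φ n)))
      (localCoord β (c (φ n)) (b (φ n))) < 0 :=
    fun n => rescale_pole_of_pole (hne _) (h1 (φ n)).2.1.2
  have hg0 := hg.eq_of_tendsto hF (x := OnePoint.infty) hq fun n => sphereValue_of_pole (hpole n)
  obtain ⟨r, hr, H, hZ, -⟩ := exists_zeroLimit hF hg hgc hg0
  have hZ' := hZ.mono (lt_min hr (by positivity : 0 < δ / 4)) (min_le_left r (δ / 4))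
  have hzero : ∀ᶠ n in atTop, ∀ z ∈ ball (0 : ℂ) (min r (δ / 4)),
      (rescale α β f (c (φ n)))⁻¹ z = 0 → z = localCoord β (c (φ n)) (b (φ n)) := by
    filter_upwards [hZ'.analytic,
      eventually_separated hβ hsep (δ / 4) (hinf.comp hφ.tendsto_atTop),
      eventually_localPoint_ne_zero hβ (δ / 4) (hinf.comp hφ.tendsto_atTop),
      hq.eventually (ball_mem_nhds 0 (by positivity : 0 < δ / 4))] with n h2 h3 h4 h5 z hz hz0
    by_contra hzne
    have hp := (hF n).pole_of_inv_eq_zero (h2 z hz) hz0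
    rw [meromorphicOrderAt_rescale (hne _)] at hp
    have hzn : ‖z‖ < δ / 4 := by simpa using ball_subset_ball (min_le_right _ _) hz
    have hbn : ‖localCoord β (c (φ n)) (b (φ n))‖ < δ / 4 := by simpa using h5
    have h6 := norm_sub_le z (localCoord β (c (φ n)) (b (φ n)))
    have h7 := h3 z (localCoord β (c (φ n)) (b (φ n))) hzn.le ⟨h4 z hzn.le, hp⟩ ⟨?_, ?_⟩
    · linarith
    · rw [localPoint_localCoord β (hne _)]
      exact (h1 (φ n)).2.1
    · intro heq
      have h8 := norm_localPoint_sub β (c (φ n)) z (localCoord β (c (φ n)) (b (φ n)))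
      rw [mem_singleton_iff] at heq
      rw [heq, sub_self, norm_zero, zero_eq_mul] at h8
      rcases h8 with h8 | h8
      · exact (Real.rpow_pos_of_pos (norm_pos_iff.mpr (hne _)) _).ne' h8
      · exact hzne (sub_eq_zero.mp (norm_eq_zero.mp h8))
  obtain ⟨n, hn, han⟩ := ((hZ'.eq_zero_of_deriv_eq_zero hq hzero (c := fun _ => 0)
    tendsto_const_nhds).and hZ'.analytic).exists
  obtain ⟨hc, -, -⟩ := h1 (φ n)
  have hnp : ¬ meromorphicOrderAt (rescale α β f (c (φ n))) 0 < 0 := by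
    rw [meromorphicOrderAt_rescale (hne _), localPoint_zero]
    exact hc.2.1
  have h2 := hn ((hF n).deriv_inv_eq_zero (han 0 (mem_ball_self hZ'.pos)) hnp (by
    rw [deriv_rescale_eq_zero_iff (hne _), localPoint_zero]
    exact hc.2.2))
  refine hnp ?_
  have h3 := hpole n
  rw [Function.comp_apply] at h2
  rwa [← h2] at h3

/-! ### The derivative of a Yosida function with separated poles -/

/-- Where the limit is finite, the derivatives converge too. -/
lemma exists_deriv_limit {F : ℕ → ℂ → ℂ} (hF : ∀ n, NontrivialMeromorphic (F n))
    {g : ℂ → OnePoint ℂ} (h : TendstoSpherically (fun n => sphereValue (F n)) g) {z₀ : ℂ}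
    (hz₀ : g z₀ ≠ OnePoint.infty) :
    ∃ r > 0, ∃ G : ℂ → ℂ, AnalyticOnNhd ℂ G (ball z₀ r) ∧
      (∀ z ∈ ball z₀ r, g z = (G z : OnePoint ℂ)) ∧
      ∀ ε > 0, ∀ᶠ n in atTop, ∀ z ∈ ball z₀ r,
        chordalDist (sphereValue (deriv (F n)) z) (deriv G z : ℂ) < ε := by
  obtain ⟨r, hr, G, h1, h2, h3⟩ := exists_analytic_limit hF h hz₀
  have hd := h2.tendstoLocallyUniformlyOn.deriv (h3.mono fun n hn z hz =>
    (hn z hz).differentiableAt.differentiableWithinAt) isOpen_ball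
  have hd' := (tendstoLocallyUniformlyOn_iff_forall_isCompact isOpen_ball).mp hd
    (closedBall z₀ (r / 2)) (closedBall_subset_ball (by linarith)) (isCompact_closedBall _ _)
  have hsub : ball z₀ (r / 2) ⊆ ball z₀ r := ball_subset_ball (by linarith)
  refine ⟨r / 2, half_pos hr, G, (analyticOnNhd_limit h2 h3).mono hsub, fun z hz => h1 z (hsub hz),
    fun ε hε => ?_⟩
  filter_upwards [Metric.tendstoUniformlyOn_iff.mp hd' ε hε, h3] with n h4 h5 z hz
  rw [sphereValue_of_not_pole (not_pole_of_analyticAt (h5 z (hsub hz)).deriv), chordalDist_comm]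
  refine (chordalDist_coe_le _ _).trans_lt ?_
  rw [← dist_eq_norm]
  exact h4 z (ball_subset_closedBall hz)

/-- Convergence is checked locally: through the derivatives themselves where `g` is finite, through
`1 / F' = -K² / K'` where `g` is infinite. -/
lemma exists_tendstoSpherically_deriv (hβ : -1 < β) (hf : IsYosida α β f)
    (h : CriticalSeparated β f) {u : ℕ → ℂ} (hu : ∀ n, 1 ≤ ‖u n‖)
    (hinf : Tendsto (fun n => ‖u n‖) atTop atTop) {g : ℂ → OnePoint ℂ}
    (hg : TendstoSpherically (fun n => sphereValue (rescale α β f (u n))) g)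
    (hgc : ¬ ∃ w, ∀ z, g z = w) :
    ∃ G, TendstoSpherically (fun n => sphereValue (rescale (α + β) β (deriv f) (u n))) G := by
  obtain ⟨δ, hδ, hsep⟩ := h
  have hne : ∀ n, u n ≠ 0 := fun n => ne_zero_of_one_le_norm (hu n)
  have hF : ∀ n, NontrivialMeromorphic (rescale α β f (u n)) :=
    fun n => hf.transcendental.nontrivialMeromorphic.rescale (hne _)
  have hF' : ∀ n, NontrivialMeromorphic (deriv (rescale α β f (u n))) := fun n => by
    rw [deriv_rescale (hne n)]
    exact hf.transcendental.deriv.nontrivialMeromorphic.rescale (hne _)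
  simp only [← deriv_rescale (hne _)]
  refine exists_tendstoSpherically_of_local fun z₀ => ?_
  by_cases hz₀ : g z₀ = OnePoint.infty
  · obtain ⟨r, hr, H, hZ, -⟩ := exists_zeroLimit hF hg hgc hz₀
    have hZ' := hZ.mono (lt_min hr (by positivity : 0 < δ / 4)) (min_le_left r (δ / 4))
    -- Hurwitz' theorem provides an actual pole of the rescaled function near `z₀`; separation then
    -- forbids critical points in the ball, and these are the only possible poles of the reciprocal
    -- derivative.
    have hreg : ∀ᶠ n in atTop, ∀ z ∈ ball z₀ (min r (δ / 4)),
        ¬ meromorphicOrderAt (deriv (rescale α β f (u n)))⁻¹ z < 0 := by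
      filter_upwards [hZ'.analytic, eventually_no_critical (α := α) hβ hsep hu hinf z₀,
        hZ'.exists_zeros hZ'.pos] with n h2 h3 ⟨p, hp, hp0⟩ z hz hbad
      have hpole := (hF n).pole_of_inv_eq_zero (h2 p hp) hp0
      obtain ⟨h4, h5⟩ := (hF' n).pole_inv_iff.mp hbad
      rw [deriv_pole_iff ((hF n).nfAt z)] at h4
      exact h3 p (ball_subset_ball (min_le_right _ _) hp) hpole z
        (ball_subset_ball (min_le_right _ _) hz) h4 h5
    have hdiff : ∀ᶠ n in atTop, DifferentiableOn ℂ
        (fun z => -((rescale α β f (u n))⁻¹ z) ^ 2 / deriv (rescale α β f (u n))⁻¹ z)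
        (ball z₀ (min r (δ / 4))) := by
      filter_upwards [hZ'.analytic, hreg] with n h2 h3
      refine DifferentiableOn.congr (f := (deriv (rescale α β f (u n)))⁻¹) (fun z hz => ?_)
        fun z hz => ((hF n).inv_deriv_eq (h2 z hz)).symm
      exact (analyticAt_of_not_pole ((hF' n).inv.nfAt z)
        (h3 z hz)).differentiableAt.differentiableWithinAt
    obtain ⟨s, hs, T, hT⟩ := hZ'.exists_tendsto_sq_div hdiff
    have hmin : 0 < min s (min r (δ / 4)) := lt_min hs hZ'.pos
    refine ⟨min s (min r (δ / 4)), hmin, fun z => sphereInv (T z : OnePoint ℂ), fun ε hε => ?_⟩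
    filter_upwards [Metric.tendstoUniformlyOn_iff.mp hT ε hε, hZ'.analytic, hreg] with n h2 h3 h4 z hz
    have e1 : sphereValue (deriv (rescale α β f (u n))) z =
        sphereInv (((-((rescale α β f (u n))⁻¹ z) ^ 2 / deriv (rescale α β f (u n))⁻¹ z : ℂ)) :
          OnePoint ℂ) := by
      have hzr := ball_subset_ball (min_le_right s _) hz
      rw [← (hF n).inv_deriv_eq (h3 z hzr), ← sphereInv_sphereInv (sphereValue _ z),
        ← (hF' n).sphereValue_inv, sphereValue_of_not_pole (h4 z hzr)]
    rw [e1, chordalDist_sphereInv, chordalDist_comm]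
    refine (chordalDist_coe_le _ _).trans_lt ?_
    rw [← dist_eq_norm]
    exact h2 z (ball_subset_ball (min_le_left _ _) hz)
  · obtain ⟨r, hr, G, -, -, h3⟩ := exists_deriv_limit hF hg hz₀
    exact ⟨r, hr, fun z => (deriv G z : ℂ), h3⟩

end Yosida

/-! ### Excluding constant limits of the derivatives -/

/-- If the derivatives have a constant limit, then the limit of the functions is affine. -/
lemma eq_affine_of_deriv_limit_const {F : ℕ → ℂ → ℂ} (hF : ∀ n, NontrivialMeromorphic (F n))
    {g : ℂ → OnePoint ℂ} (hg : TendstoSpherically (fun n => sphereValue (F n)) g)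
    (hgc : ¬ ∃ w, ∀ z, g z = w) {w : OnePoint ℂ}
    (hw : TendstoSpherically (fun n => sphereValue (deriv (F n))) fun _ => w) :
    ∃ a c : ℂ, a ≠ 0 ∧ ∀ z, g z = ((a * z + c : ℂ) : OnePoint ℂ) := by
  have key : ∀ z₀, g z₀ ≠ OnePoint.infty → ∃ r > 0, ∃ G : ℂ → ℂ, AnalyticOnNhd ℂ G (ball z₀ r) ∧
      (∀ z ∈ ball z₀ r, g z = (G z : OnePoint ℂ)) ∧
      ∀ z ∈ ball z₀ r, w = ((deriv G z : ℂ) : OnePoint ℂ) := by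
    intro z₀ hz₀
    obtain ⟨r, hr, G, h1, h2, h3⟩ := exists_deriv_limit hF hg hz₀
    refine ⟨r, hr, G, h1, h2, fun z hz => ?_⟩
    refine stereo_injective (tendsto_nhds_unique (hw.tendsto_at z) ?_)
    rw [Metric.tendsto_nhds]
    intro ε hε
    filter_upwards [h3 ε hε] with n hn
    rw [dist_stereo]
    exact hn z hz
  obtain ⟨z₁, hz₁⟩ : ∃ z₁, g z₁ ≠ OnePoint.infty := by
    by_contra! hall
    exact hgc ⟨_, hall⟩
  obtain ⟨a, rfl⟩ : ∃ a : ℂ, w = a := by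
    obtain ⟨r, hr, G, -, -, h3⟩ := key z₁ hz₁
    exact ⟨_, h3 z₁ (mem_ball_self hr)⟩
  simp only [OnePoint.coe_eq_coe] at key
  -- At a pole of `g = 1 / H` the derivative of `1 / H` would have a pole, yet it equals the
  -- constant `a` on a punctured neighbourhood.
  have hfin : ∀ z, g z ≠ OnePoint.infty := by
    intro z₀ hz₀
    obtain ⟨r, hr, H, hZ, hH⟩ := exists_zeroLimit hF hg hgc hz₀
    have hd : deriv H⁻¹ =ᶠ[𝓝[≠] z₀] fun _ => a := by
      filter_upwards [(meromorphicOrderAt_ne_top_iff_eventually_ne_zero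
        hZ.analyticAt.meromorphicAt).mp hZ.limit_order_ne_top,
        mem_nhdsWithin_of_mem_nhds (ball_mem_nhds z₀ hr)] with y hy hyb
      obtain ⟨s, hs, G, -, h2, h3⟩ := key y (by
        rw [hH y hyb, sphereInv_coe hy]; exact OnePoint.coe_ne_infty _)
      rw [h3 y (mem_ball_self hs)]
      refine Filter.EventuallyEq.deriv_eq ?_
      filter_upwards [ball_mem_nhds y hs, isOpen_ball.mem_nhds hyb,
        (hZ.analyticOnNhd y hyb).continuousAt.eventually_ne hy] with x hx1 hx2 hx3
      have := hH x hx2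
      rw [h2 x hx1, sphereInv_coe hx3, OnePoint.coe_eq_coe] at this
      exact this.symm
    have hpos : 0 < meromorphicOrderAt H z₀ :=
      lt_of_le_of_ne hZ.analyticAt.meromorphicOrderAt_nonneg fun h =>
        hZ.analyticAt.meromorphicNFAt.meromorphicOrderAt_eq_zero_iff.mp h.symm hZ.apply_eq_zero
    have hneg := meromorphicOrderAt_deriv_lt_zero
      (inv_pole_iff.mpr ⟨hpos, hZ.limit_order_ne_top⟩)
    rw [meromorphicOrderAt_congr hd] at hneg
    exact not_pole_of_analyticAt analyticAt_const hneg
  choose v hv using fun z => OnePoint.ne_infty_iff_exists.mp (hfin z)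
  have hderiv : ∀ z, HasDerivAt v a z := by
    intro z
    obtain ⟨r, hr, G, h1, h2, h3⟩ := key z (hfin z)
    have hG : HasDerivAt G a z := by
      rw [h3 z (mem_ball_self hr)]
      exact (h1 z (mem_ball_self hr)).differentiableAt.hasDerivAt
    refine hG.congr_of_eventuallyEq ?_
    filter_upwards [ball_mem_nhds z hr] with x hx
    have := h2 x hx
    rw [← hv x, OnePoint.coe_eq_coe] at this
    exact this
  have hconst : ∀ z, v z - a * z = v 0 - a * 0 := fun z => by
    have h1 : ∀ x, HasDerivAt (fun z => v z - a * z) 0 x := fun x => by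
      have h2 := (hderiv x).fun_sub ((hasDerivAt_id' x).const_mul a)
      rwa [mul_one, sub_self] at h2
    exact is_const_of_deriv_eq_zero (fun x => (h1 x).differentiableAt) (fun x => (h1 x).deriv) z 0
  have hval : ∀ z, v z = a * z + v 0 := fun z => by linear_combination hconst z
  refine ⟨a, v 0, ?_, fun z => by rw [← hv z, hval z]⟩
  rintro rfl
  exact hgc ⟨v 0, fun z => by rw [← hv z, hval z]; simp⟩

lemma chordalDist_mul_infty_le {s v : ℂ} (hs : 1 / 2 ≤ ‖s‖) :
    chordalDist ((s * v : ℂ) : OnePoint ℂ) OnePoint.infty ≤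
      2 * chordalDist (v : OnePoint ℂ) OnePoint.infty := by
  rw [chordalDist_coe_infty, chordalDist_coe_infty, mul_one_div,
    div_le_div_iff₀ (by positivity) (by positivity), one_mul,
    Real.sqrt_le_left (by positivity), mul_pow, Real.sq_sqrt (by positivity), norm_mul, mul_pow]
  have : 1 / 4 ≤ ‖s‖ ^ 2 := by nlinarith
  nlinarith [sq_nonneg ‖v‖]

lemma chordalDist_infty_le {v : ℂ} {M : ℝ} (hM : 0 < M) (hv : M ≤ ‖v‖) :
    chordalDist (v : OnePoint ℂ) OnePoint.infty ≤ 1 / M := by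
  rw [chordalDist_coe_infty]
  refine one_div_le_one_div_of_le hM (hv.trans ?_)
  exact Real.le_sqrt_of_sq_le (by linarith)

section Yosida

variable {α β : ℝ} {f : ℂ → ℂ}

/-- Changing the base point to a nearby one changes the rescaled function by an affine change of
variables and a bounded factor. -/
lemma chordalDist_rescale_localPoint_le {h x : ℂ} (hh : h ≠ 0) (hx : x ≠ 0) {k z : ℂ}
    (hxk : x = localPoint β h k) (hα : ‖x‖ ^ α ≤ 2 * ‖h‖ ^ α) :
    chordalDist (sphereValue (rescale α β f x) z) OnePoint.infty ≤
      2 * chordalDist (sphereValue (rescale α β f h)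
        (k + x ^ (-(β : ℂ)) / h ^ (-(β : ℂ)) * z)) OnePoint.infty := by
  classical
  have hpt : localPoint β h (k + x ^ (-(β : ℂ)) / h ^ (-(β : ℂ)) * z) = localPoint β x z := by
    have h1 := cpow_neg_ne_zero hh β
    simp only [localPoint] at hxk ⊢
    field_simp
    linear_combination -hxk
  rw [sphereValue_rescale hh, sphereValue_rescale hx, hpt]
  by_cases hp : meromorphicOrderAt f (localPoint β x z) < 0
  · rw [if_pos hp, if_pos hp, chordalDist_infty_infty]
    norm_num
  · rw [if_neg hp, if_neg hp]
    have h1 := cpow_neg_ne_zero hh α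
    have h2 : x ^ (-(α : ℂ)) * f (localPoint β x z) = x ^ (-(α : ℂ)) / h ^ (-(α : ℂ)) *
        (h ^ (-(α : ℂ)) * f (localPoint β x z)) := by field_simp
    rw [h2]
    refine chordalDist_mul_infty_le ?_
    have hh' : 0 < ‖h‖ ^ α := Real.rpow_pos_of_pos (norm_pos_iff.mpr hh) α
    have hx' : 0 < ‖x‖ ^ α := Real.rpow_pos_of_pos (norm_pos_iff.mpr hx) α
    rw [norm_div, norm_cpow_neg_real, norm_cpow_neg_real, Real.rpow_neg (norm_nonneg _),
      Real.rpow_neg (norm_nonneg _), inv_div_inv, div_le_div_iff₀ (by norm_num) hx']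
    linarith

/-- Affine functions do not occur as limit functions, as their translates tend to `∞`. -/
lemma IsYosida.not_affine_limit (hβ : -1 < β) (hf : IsYosida α β f) {h : ℕ → ℂ}
    (hinf : Tendsto (fun n => ‖h n‖) atTop atTop) {a c : ℂ} (ha : a ≠ 0)
    (hg : TendstoSpherically (fun n => sphereValue (rescale α β f (h n)))
      fun z => ((a * z + c : ℂ) : OnePoint ℂ)) : False := by
  have ha' : 0 < ‖a‖ := norm_pos_iff.mpr ha
  -- A diagonal choice: `x` has local coordinate `k` at some `h n`, with `n` so large that the
  -- rescaling is within `1 / (k + 1)` of the affine limit on the disc of radius `2 * k`. The change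
  -- of base point stretches by at most `2`, so `‖z‖ ≤ k / 4` leads to a coordinate `ζ` with `k / 2
  -- ≤ ‖ζ‖ ≤ 2 * k`, where `a * ζ + c` is large.
  have hchoice : ∀ k : ℕ, ∃ x : ℂ, (k : ℝ) ≤ ‖x‖ ∧ ∀ z : ℂ, ‖z‖ ≤ k / 4 →
      0 < ‖a‖ * (k / 2) - ‖c‖ →
      chordalDist (sphereValue (rescale α β f x) z) OnePoint.infty ≤
        2 * (1 / ((k : ℝ) + 1) + 1 / (‖a‖ * (k / 2) - ‖c‖)) := by
    intro k
    obtain ⟨N₁, hN₁, hc₁⟩ := localPoint_comparable hβ α k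
    obtain ⟨N₂, hN₂, hc₂⟩ := localPoint_comparable hβ (-β) k
    obtain ⟨n, hn1, hn2, hn3, hn4⟩ := ((hinf.eventually_ge_atTop N₁).and
      ((hinf.eventually_ge_atTop N₂).and ((hinf.eventually_ge_atTop (2 * k)).and
        (hg (closedBall 0 (2 * k)) (isCompact_closedBall _ _) (1 / ((k : ℝ) + 1))
          (by positivity))))).exists
    have hk : ‖(k : ℂ)‖ ≤ k := by simp
    obtain ⟨e1, e2⟩ := hc₁ (h n) hn1 k hk
    obtain ⟨-, e3⟩ := hc₂ (h n) hn2 k hk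
    have hhpos : 0 < ‖h n‖ := hN₁.trans_le hn1
    have hh : h n ≠ 0 := norm_pos_iff.mp hhpos
    have hx : localPoint β (h n) k ≠ 0 := norm_pos_iff.mp (by linarith)
    refine ⟨localPoint β (h n) k, by linarith, fun z hz hM => ?_⟩
    refine (chordalDist_rescale_localPoint_le hh hx rfl e2).trans ?_
    set ζ := (k : ℂ) + localPoint β (h n) k ^ (-(β : ℂ)) / h n ^ (-(β : ℂ)) * z with hζ
    have hratio : ‖localPoint β (h n) k ^ (-(β : ℂ)) / h n ^ (-(β : ℂ)) * z‖ ≤ k / 2 := by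
      rw [norm_mul, norm_div, norm_cpow_neg_real, norm_cpow_neg_real]
      have : ‖localPoint β (h n) k‖ ^ (-β) / ‖h n‖ ^ (-β) ≤ 2 := by
        rwa [div_le_iff₀ (Real.rpow_pos_of_pos hhpos _)]
      calc _ ≤ 2 * ((k : ℝ) / 4) := by gcongr
        _ = k / 2 := by ring
    have hζ1 : ‖ζ‖ ≤ 2 * k := by
      have h1 := norm_add_le (k : ℂ) (localPoint β (h n) k ^ (-(β : ℂ)) / h n ^ (-(β : ℂ)) * z)
      rw [← hζ] at h1
      have h2 : (0 : ℝ) ≤ k := k.cast_nonneg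
      linarith
    have hζ2 : (k : ℝ) / 2 ≤ ‖ζ‖ := by
      have h1 := norm_sub_le ζ (localPoint β (h n) k ^ (-(β : ℂ)) / h n ^ (-(β : ℂ)) * z)
      rw [hζ, add_sub_cancel_right, ← hζ, Complex.norm_natCast] at h1
      linarith
    have h1 := hn4 ζ (by simpa using hζ1)
    have h2 : ‖a‖ * (k / 2) - ‖c‖ ≤ ‖a * ζ + c‖ := by
      have h3 := norm_sub_le (a * ζ + c) c
      rw [add_sub_cancel_right, norm_mul] at h3
      have h4 : ‖a‖ * (k / 2) ≤ ‖a‖ * ‖ζ‖ := by gcongr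
      linarith
    have h3 := chordalDist_infty_le hM h2
    have h4 := chordalDist_triangle (sphereValue (rescale α β f (h n)) ζ)
      ((a * ζ + c : ℂ) : OnePoint ℂ) OnePoint.infty
    linarith
  choose x hx1 hx2 using hchoice
  refine hf.nonconstant (fun _ => OnePoint.infty) ⟨x, ?_, ?_⟩ ⟨_, fun _ => rfl⟩
  · exact tendsto_atTop_mono hx1 tendsto_natCast_atTop_atTop
  · intro K hK ε hε
    obtain ⟨B, hB⟩ := isBounded_iff_forall_norm_le.mp hK.isBounded
    have hlin : Tendsto (fun k : ℕ => ‖a‖ * ((k : ℝ) / 2) - ‖c‖) atTop atTop :=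
      tendsto_atTop_add_const_right _ _ (Tendsto.const_mul_atTop ha'
        (tendsto_natCast_atTop_atTop.atTop_div_const two_pos))
    have hlim : Tendsto (fun k : ℕ => 2 * (1 / ((k : ℝ) + 1) + 1 / (‖a‖ * (k / 2) - ‖c‖)))
        atTop (𝓝 0) := by
      have h1 := (tendsto_one_div_add_atTop_nhds_zero_nat (𝕜 := ℝ)).add
        (tendsto_const_nhds (x := (1 : ℝ)).div_atTop hlin)
      simpa using h1.const_mul 2
    filter_upwards [hlim.eventually_lt_const hε, hlin.eventually_gt_atTop 0,
      (tendsto_natCast_atTop_atTop (R := ℝ)).eventually_ge_atTop (4 * B)] with k h1 h2 h3 z hz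
    have h4 := hB z hz
    exact (hx2 k z (by linarith) h2).trans_lt h1

theorem isYosida_deriv_of_criticalSeparated (hβ : -1 < β) (hf : IsYosida α β f)
    (h : CriticalSeparated β f) : IsYosida (α + β) β (deriv f) where
  transcendental := hf.transcendental.deriv
  normal := by
    intro u
    by_cases hinf : Tendsto (fun n => ‖(u n : ℂ)‖) atTop atTop
    · obtain ⟨φ, hφ, g, hg, hgc⟩ := hf.exists_subseq (h := fun n => (u n : ℂ))
        (fun n => (u n).2) hinf
      obtain ⟨G, hG⟩ := exists_tendstoSpherically_deriv (u := fun n => (u (φ n) : ℂ)) hβ hf h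
        (fun n => (u (φ n)).2) (hinf.comp hφ.tendsto_atTop) hg hgc
      exact ⟨φ, hφ, G, hG⟩
    · exact exists_subseq_of_not_tendsto (h := fun n => (u n : ℂ))
        hf.transcendental.deriv.nontrivialMeromorphic (fun n => (u n).2) hinf
  nonconstant := by
    rintro G ⟨u, hu, hG⟩ ⟨w, hw⟩
    obtain rfl : G = fun _ => w := funext hw
    -- A limit function may come from base points inside the unit disc at first; normality of `f` is
    -- available only after these are dropped.
    obtain ⟨N, hN⟩ := eventually_atTop.mp (hu.eventually_ge_atTop 1)
    have hN' : ∀ n, 1 ≤ ‖u (n + N)‖ := fun n => hN _ (Nat.le_add_left _ _)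
    have hinf := hu.comp (tendsto_add_atTop_nat N)
    obtain ⟨φ, hφ, g, hg, hgc⟩ := hf.exists_subseq hN' hinf
    have hne : ∀ n, u (φ n + N) ≠ 0 := fun n => ne_zero_of_one_le_norm (hN' _)
    have hG' := hG.comp_tendsto ((tendsto_add_atTop_nat N).comp hφ.tendsto_atTop)
    simp only [Function.comp_apply, ← deriv_rescale (hne _)] at hG'
    obtain ⟨a, c, ha, hac⟩ := eq_affine_of_deriv_limit_const
      (fun n => hf.transcendental.nontrivialMeromorphic.rescale (hne n)) hg hgc hG'
    obtain rfl : g = fun z => ((a * z + c : ℂ) : OnePoint ℂ) := funext hac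
    exact hf.not_affine_limit hβ (hinf.comp hφ.tendsto_atTop) ha hg

end Yosida

end GeneralizedYosida

open GeneralizedYosida in
theorem theorem14 (α β : ℝ) (hβ : -1 < β) (f : ℂ → ℂ) (hf : IsYosida α β f) :
    (IsYosida (α + β) β (deriv f) ↔
      0 < ⨅ p ∈ poles f, ENNReal.ofReal (‖p‖ ^ β) * Metric.infEDist p (poles f \ {p})) ∧
    (IsYosida (α + β) β (deriv f) ↔
      0 < ⨅ c ∈ criticalPoints f, ENNReal.ofReal (‖c‖ ^ β) * Metric.infEDist c (poles f)) := by
  rw [separated_iff (A := poles f) (B := fun p => poles f \ {p}) fun c hc => hc.1,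
    separated_iff (A := criticalPoints f) (B := fun _ => poles f) fun c hc => hc.1]
  have h1 : IsYosida (α + β) β (deriv f) ↔ CriticalSeparated β f :=
    ⟨criticalSeparated_of_isYosida_deriv hf.transcendental,
      isYosida_deriv_of_criticalSeparated hβ hf⟩
  exact ⟨h1.trans ⟨polesSeparated_of_criticalSeparated hβ hf,
    criticalSeparated_of_polesSeparated hβ hf⟩, h1⟩
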